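/- Let $S>0$, let $M=(m_{ij})$ be a real $2\times 2$ matrix with $\det M=1$, let $\alpha\in[0,\pi)$ and $\beta\in(0,\pi]$. For a real-valued $q\in L^2[-S,S]$ and $\lambda\in\mathbb C$, a solution of the transfer problem is a function $y$ satisfying $-y''+qy=\lambda y$ on $[-S,0)\cup(0,S]$ (i.e. $y$ is continuously differentiable, $y'$ is locally absolutely continuous there and the equation holds almost everywhere) such that the one-sided limits of $y$ and $y'$ at $0$ exist and satisfy $$\begin{pmatrix}y(0^+)\\ y'(0^+)\end{pmatrix}=M\begin{pmatrix}y(0^-)\\ y'(0^-)\end{pmatrix}.$$ Let $u_\alpha(\cdot,\lambda)$, $w_\alpha(\cdot,\lambda)$ be the solutions with $$u_\alpha(-S)=\cos\alpha,\quad u_\alpha'(-S)=-\sin\alpha,\quad w_\alpha(-S)=\sin\alpha,\quad w_\alpha'(-S)=\cos\alpha .$$ The Titchmarsh–Weyl $m$-function of the problem with the boundary conditions $y(-S)\cos\alpha-y'(-S)\sin\alpha=0$ and $y(S)\cos\beta-y'(S)\sin\beta=0$ assigns to each $\lambda\in\mathbb C$ that is not an eigenvalue of this problem the unique number $m(\lambda)$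 for which $\psi=u_\alpha+m(\lambda)w_\alpha$ satisfies $\psi(S)\cos\beta-\psi'(S)\sin\beta=0$. Theorem. Let $q,\tilde q\in L^2[-S,S]$ be real-valued, and let $m$ and $\tilde m$ be the Titchmarsh–Weyl $m$-functions of the problems with potentials $q$ and $\tilde q$ respectively, with the same $S$, $M$, $\alpha$, $\beta$. If $m=\tilde m$ (it suffices that $m(\lambda)=\tilde m(\lambda)$ for every $\lambda\in\mathbb C$ at which both are defined), then $q=\tilde q$ almost everywhere on $[-S,S]$. -/

import Mathlib

open MeasureTheory Filter Topology

namespace TransferSL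

/-- `y`, with derivative `dy`, is a (Carathéodory) solution of `-y'' + q y = lam y` on the compact
interval `[a, b]`: `y` is differentiable with `y' = dy` (one-sidedly at the end points), `y'` is
absolutely continuous, and the equation holds almost everywhere. -/
structure SolvesOn (q : ℝ → ℝ) (lam : ℂ) (a b : ℝ) (y dy : ℝ → ℂ) : Prop where
  hasDeriv : ∀ x ∈ Set.Icc a b, HasDerivWithinAt y (dy x) (Set.Icc a b) x
  absCont : AbsolutelyContinuousOnInterval dy a b
  equation : ∀ᵐ x ∂(volume.restrict (Set.Icc a b)),
    ∃ ddy : ℂ, HasDerivAt dy ddy x ∧ -ddy + (q x : ℂ) * y x = lam * y x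

/-- `y`, with derivative `dy`, solves `-y'' + q y = lam y` on `[-S, 0) ∪ (0, S]` and satisfies the
transfer condition `(y(0⁺), y'(0⁺)) = M (y(0⁻), y'(0⁻))`. The values at `0` itself play no role. -/
structure IsSolution (S : ℝ) (M : Matrix (Fin 2) (Fin 2) ℝ) (q : ℝ → ℝ) (lam : ℂ)
    (y dy : ℝ → ℂ) : Prop where
  left : ∀ c ∈ Set.Ioo (-S) 0, SolvesOn q lam (-S) c y dy
  right : ∀ c ∈ Set.Ioo 0 S, SolvesOn q lam c S y dy
  transfer : ∃ yl dyl yr dyr : ℂ,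
    Tendsto y (𝓝[<] 0) (𝓝 yl) ∧ Tendsto dy (𝓝[<] 0) (𝓝 dyl) ∧
    Tendsto y (𝓝[>] 0) (𝓝 yr) ∧ Tendsto dy (𝓝[>] 0) (𝓝 dyr) ∧
    yr = (M 0 0 : ℂ) * yl + (M 0 1 : ℂ) * dyl ∧
    dyr = (M 1 0 : ℂ) * yl + (M 1 1 : ℂ) * dyl

/-- `m` is a value for which `ψ = u + m w` satisfies the condition
`ψ(S) cos β - ψ'(S) sin β = 0`, where `u, w` are the solutions with
`u(-S) = cos α`, `u'(-S) = -sin α`, `w(-S) = sin α`, `w'(-S) = cos α`. -/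
def IsWeylValue (S : ℝ) (M : Matrix (Fin 2) (Fin 2) ℝ) (α β : ℝ) (q : ℝ → ℝ) (lam m : ℂ) : Prop :=
  ∃ u du w dw : ℝ → ℂ,
    IsSolution S M q lam u du ∧ IsSolution S M q lam w dw ∧
    u (-S) = (Real.cos α : ℂ) ∧ du (-S) = -(Real.sin α : ℂ) ∧
    w (-S) = (Real.sin α : ℂ) ∧ dw (-S) = (Real.cos α : ℂ) ∧
    (u S + m * w S) * (Real.cos β : ℂ) - (du S + m * dw S) * (Real.sin β : ℂ) = 0

/-- The Titchmarsh–Weyl `m`-function, as a partial function on `ℂ`: it is defined at those `lam`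
for which there is exactly one Weyl value (that is, at every `lam` that is not an eigenvalue), and
takes that value there. -/
noncomputable def titchmarshWeyl (S : ℝ) (M : Matrix (Fin 2) (Fin 2) ℝ) (α β : ℝ) (q : ℝ → ℝ) :
    ℂ →. ℂ :=
  fun lam => ⟨∃! m, IsWeylValue S M α β q lam m, fun h => h.choose⟩

end TransferSL

/-! Write `lam = -κ ^ 2`, let primes mark the quantities belonging to `q'`, and let `B` be the
boundary form at `S`. Fix `x ≠ 0` inside the interval and consider `F(lam) = w'(x) u(x) - w(x)
u'(x)`, which is entire. Wherever the two Weyl values exist and agree, the terms in `m` cancel, so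
that `F = w' ψ - w ψ'` with `ψ = u + m w` and `ψ' = u' + m w'`.

As `Re κ → ∞`, the leading growth of `w` at `x` does not depend on the potential. It is a product of
exponentials with explicit factors from the initial data and from `M` (`GrowsLike.solvesOn`,
`PurelyGrowsLike.transfer`). Hence `w' ψ` is asymptotic to the diagonal Green function `w ψ`, which
behaves like `1 / (2κ)` (`TransferFamily.tendsto_green`), and likewise for `w ψ'`. So `F` tends to
zero. Since `F` has at most exponential growth in `κ`, that is, order at most `1/2` in `lam`,
Phragmén–Lindelöf and Liouville give `F = 0` (`eq_zero_of_expGrowth_of_tendsto`).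

Thus `w' u = w u'` for all `lam` and all such `x`. Formally `u / w = u' / w'`, and the unit
Wronskians turn the derivative of this identity into `w ^ 2 = w' ^ 2`. Two more differentiations
recover the potential wherever `w ≠ 0` (`ae_eq_of_mul_eq`). For every `x` some `lam` makes `w(x)`
nonzero, so the potentials agree almost everywhere near `x`. -/

/-! ### Absolutely continuous complex-valued functions. -/

theorem AbsolutelyContinuousOnInterval.of_dist_le {X Y : Type*} [PseudoMetricSpace X]
    [PseudoMetricSpace Y] {f : ℝ → X} {g : ℝ → Y} {a b : ℝ}
    (hg : AbsolutelyContinuousOnInterval g a b)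
    (h : ∀ x ∈ Set.uIcc a b, ∀ y ∈ Set.uIcc a b, dist (f x) (f y) ≤ dist (g x) (g y)) :
    AbsolutelyContinuousOnInterval f a b := by
  refine squeeze_zero' (Eventually.of_forall fun E => by positivity) ?_ hg
  have : ∀ᶠ E in (AbsolutelyContinuousOnInterval.totalLengthFilter ⊓
      𝓟 (AbsolutelyContinuousOnInterval.disjWithin a b)),
      E ∈ AbsolutelyContinuousOnInterval.disjWithin a b :=
    mem_inf_of_right (mem_principal_self _)
  filter_upwards [this] with E hE
  refine Finset.sum_le_sum fun i hi => ?_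
  exact h _ (hE.1 i hi).1 _ (hE.1 i hi).2

/-- Increments of the primitive are dominated by those of the real primitive of `‖g‖`. -/
theorem IntervalIntegrable.absolutelyContinuousOnInterval_primitive {g : ℝ → ℂ} {a b c : ℝ}
    (hg : IntervalIntegrable g volume a b) (hc : c ∈ Set.uIcc a b) :
    AbsolutelyContinuousOnInterval (fun x => ∫ t in c..x, g t) a b := by
  have hn := hg.norm.absolutelyContinuousOnInterval_intervalIntegral hc
  refine AbsolutelyContinuousOnInterval.of_dist_le hn fun x hx y hy => ?_
  have hI : ∀ s ∈ Set.uIcc a b, ∀ t ∈ Set.uIcc a b, IntervalIntegrable g volume s t :=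
    fun s hs t ht => hg.mono_set (Set.uIcc_subset_uIcc hs ht)
  rw [dist_eq_norm, dist_eq_norm,
    intervalIntegral.integral_interval_sub_left (hI _ hc _ hx) (hI _ hc _ hy),
    intervalIntegral.integral_interval_sub_left (hI _ hc _ hx).norm (hI _ hc _ hy).norm]
  exact intervalIntegral.norm_integral_le_abs_integral_norm

/-- Fundamental theorem of calculus for absolutely continuous complex-valued functions. -/
theorem AbsolutelyContinuousOnInterval.eq_add_integral {f g : ℝ → ℂ} {a b : ℝ} (hab : a ≤ b)
    (hf : AbsolutelyContinuousOnInterval f a b) (hg : IntervalIntegrable g volume a b)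
    (h : ∀ᵐ x ∂(volume.restrict (Set.Icc a b)), HasDerivAt f (g x) x) :
    ∀ x ∈ Set.Icc a b, f x = f a + ∫ t in a..x, g t := by
  have h1 := hf.sub (hg.absolutelyContinuousOnInterval_primitive (c := a) (by simp))
  rw [ae_restrict_iff' measurableSet_Icc] at h
  obtain ⟨C, hC⟩ := h1.const_of_ae_hasDerivAt_zero (by
    filter_upwards [h, hg.ae_hasDerivAt_integral] with x hx1 hx2 hx
    have := (hx1 (by rwa [Set.uIcc_of_le hab] at hx)).sub (hx2 hx a (by simp))
    simpa using this)
  rw [Set.uIcc_of_le hab] at hC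
  intro x hx
  have h2 := hC x hx
  have h3 := hC a (Set.left_mem_Icc.2 hab)
  simp at h2 h3
  rw [h3, ← h2]; ring

theorem absolutelyContinuousOnInterval_of_hasDerivWithinAt {y dy : ℝ → ℂ} {a b : ℝ} (hab : a ≤ b)
    (h : ∀ x ∈ Set.Icc a b, HasDerivWithinAt y (dy x) (Set.Icc a b) x)
    (hc : ContinuousOn dy (Set.Icc a b)) : AbsolutelyContinuousOnInterval y a b := by
  obtain ⟨C, hC⟩ := isCompact_Icc.exists_bound_of_continuousOn hc
  have hl : LipschitzOnWith (Real.toNNReal C) y (Set.Icc a b) := by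
    refine (convex_Icc a b).lipschitzOnWith_of_nnnorm_hasDerivWithin_le h fun x hx => ?_
    rw [← NNReal.coe_le_coe]
    exact (hC x hx).trans (Real.le_coe_toNNReal C)
  rw [← Set.uIcc_of_le hab] at hl
  exact hl.absolutelyContinuousOnInterval

theorem ae_mem_Ioo_of_restrict_Icc (a b : ℝ) :
    ∀ᵐ x ∂(volume.restrict (Set.Icc a b)), x ∈ Set.Ioo a b := by
  rw [← restrict_Ioo_eq_restrict_Icc]
  exact ae_restrict_mem measurableSet_Ioo

/-! ### Carathéodory solutions and their Wronskian. -/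

namespace TransferSL

variable {q : ℝ → ℝ} {lam : ℂ} {a b : ℝ} {y dy z dz : ℝ → ℂ}

theorem SolvesOn.mono (h : SolvesOn q lam a b y dy) {c d : ℝ} (hcd : c ≤ d)
    (hs : Set.Icc c d ⊆ Set.Icc a b) : SolvesOn q lam c d y dy where
  hasDeriv x hx := (h.hasDeriv x (hs hx)).mono hs
  absCont := h.absCont.mono (by
    rw [Set.uIcc_of_le hcd]; exact hs.trans Set.Icc_subset_uIcc)
  equation := ae_restrict_of_ae_restrict_of_subset hs h.equation

theorem SolvesOn.smul_add_smul (h : SolvesOn q lam a b y dy) (h' : SolvesOn q lam a b z dz)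
    (c d : ℂ) : SolvesOn q lam a b (fun x => c * y x + d * z x) (fun x => c * dy x + d * dz x) where
  hasDeriv x hx := ((h.hasDeriv x hx).const_mul c).add ((h'.hasDeriv x hx).const_mul d)
  absCont := (h.absCont.const_smul c).add (h'.absCont.const_smul d)
  equation := by
    filter_upwards [h.equation, h'.equation] with x ⟨s, hs, es⟩ ⟨t, ht, et⟩
    exact ⟨c * s + d * t, (hs.const_mul c).add (ht.const_mul d), by
      linear_combination c * es + d * et⟩

theorem SolvesOn.continuousOn (h : SolvesOn q lam a b y dy) : ContinuousOn y (Set.Icc a b) :=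
  fun x hx => (h.hasDeriv x hx).continuousWithinAt

theorem SolvesOn.continuousOn_deriv (h : SolvesOn q lam a b y dy) (hab : a ≤ b) :
    ContinuousOn dy (Set.Icc a b) := by
  have := h.absCont.continuousOn
  rwa [Set.uIcc_of_le hab] at this

theorem SolvesOn.absCont_fun (h : SolvesOn q lam a b y dy) (hab : a ≤ b) :
    AbsolutelyContinuousOnInterval y a b :=
  absolutelyContinuousOnInterval_of_hasDerivWithinAt hab h.hasDeriv (h.continuousOn_deriv hab)

theorem SolvesOn.ae_hasDerivAt (h : SolvesOn q lam a b y dy) :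
    ∀ᵐ x ∂(volume.restrict (Set.Icc a b)),
      HasDerivAt y (dy x) x ∧ HasDerivAt dy (((q x : ℂ) - lam) * y x) x := by
  filter_upwards [h.equation, ae_mem_Ioo_of_restrict_Icc a b] with x ⟨s, hs, es⟩ hx
  refine ⟨(h.hasDeriv x (Set.Ioo_subset_Icc_self hx)).hasDerivAt (Icc_mem_nhds hx.1 hx.2), ?_⟩
  convert hs using 1
  linear_combination es

/-- The Wronskian of two solutions is constant. -/
theorem SolvesOn.wronskian_eq (h : SolvesOn q lam a b y dy) (h' : SolvesOn q lam a b z dz)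
    {s t : ℝ} (hs : s ∈ Set.Icc a b) (ht : t ∈ Set.Icc a b) :
    y s * dz s - dy s * z s = y t * dz t - dy t * z t := by
  have hab : a ≤ b := hs.1.trans hs.2
  have hac : AbsolutelyContinuousOnInterval (fun x => y x * dz x - dy x * z x) a b :=
    ((h.absCont_fun hab).smul h'.absCont).sub (h.absCont.smul (h'.absCont_fun hab))
  have := hac.eq_add_integral hab (g := fun _ => 0) (by simp) (by
    filter_upwards [h.ae_hasDerivAt, h'.ae_hasDerivAt] with x ⟨h1, h2⟩ ⟨h3, h4⟩
    refine ((h1.mul h4).sub (h2.mul h3)).congr_deriv ?_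
    ring)
  rw [this s hs, this t ht]
  simp

end TransferSL

/-! ### Existence of solutions, entire in the spectral parameter, by a Volterra equation. -/

namespace TransferSL

variable {a b : ℝ}

theorem intervalIntegrable_mul_IccExtend (hab : a ≤ b) {p : ℝ → ℂ}
    (hp : IntervalIntegrable p volume a b) (f : C(Set.Icc a b, ℂ)) {s t : ℝ}
    (hs : s ∈ Set.Icc a b) (ht : t ∈ Set.Icc a b) :
    IntervalIntegrable (fun t => p t * Set.IccExtend hab f t) volume s t := by
  rw [← Set.uIcc_of_le hab] at hs ht
  exact (hp.mono_set (Set.uIcc_subset_uIcc hs ht)).mul_continuousOn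
    (f.continuous.Icc_extend' (h := hab)).continuousOn

/-- Only values of `f` up to `x` enter. This causality lets pointwise bounds that increase with `x`
be iterated in `norm_pow_primitiveOp_comp_le`. -/
theorem norm_integral_mul_IccExtend_le (hab : a ≤ b) {p : ℝ → ℂ}
    (hp : IntervalIntegrable p volume a b) (f : C(Set.Icc a b, ℂ)) {x : ℝ}
    (hx : x ∈ Set.Icc a b) {c : ℝ} (hc : 0 ≤ c)
    (hf : ∀ t : Set.Icc a b, (t : ℝ) ≤ x → ‖f t‖ ≤ c) :
    ‖∫ t in a..x, p t * Set.IccExtend hab f t‖ ≤ (∫ t in a..b, ‖p t‖) * c := by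
  have hsub : Set.uIcc a x ⊆ Set.uIcc a b := by
    rw [Set.uIcc_of_le hab, Set.uIcc_of_le hx.1]; exact Set.Icc_subset_Icc_right hx.2
  have h1 : ‖∫ t in a..x, p t * Set.IccExtend hab f t‖ ≤ ∫ t in a..x, ‖p t‖ * c := by
    refine intervalIntegral.norm_integral_le_of_norm_le hx.1 (ae_of_all _ fun t ht => ?_)
      ((hp.norm.mono_set hsub).mul_const c)
    have htm : t ∈ Set.Icc a b := ⟨ht.1.le, ht.2.trans hx.2⟩
    rw [norm_mul, Set.IccExtend_of_mem _ _ htm]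
    gcongr
    exact hf ⟨t, htm⟩ ht.2
  refine h1.trans ?_
  rw [intervalIntegral.integral_mul_const]
  gcongr
  refine intervalIntegral.integral_mono_interval le_rfl hx.1 hx.2 ?_ hp.norm
  exact ae_of_all _ fun t => norm_nonneg _

theorem continuous_integral_mul_IccExtend (hab : a ≤ b) {p : ℝ → ℂ}
    (hp : IntervalIntegrable p volume a b) (f : C(Set.Icc a b, ℂ)) :
    Continuous fun x : Set.Icc a b => ∫ t in a..x, p t * Set.IccExtend hab f t := by
  have h := intervalIntegral.continuousOn_primitive_interval'
    (intervalIntegrable_mul_IccExtend hab hp f (Set.left_mem_Icc.2 hab)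
      (Set.right_mem_Icc.2 hab)) (a := a) (by simp)
  rw [Set.uIcc_of_le hab] at h
  exact h.domRestrict

/-- `1 - x` is a commuting factor of the unit `1 - x ^ n`. -/
theorem isUnit_one_sub_of_norm_pow_lt_one {R : Type*} [NormedRing R] [HasSummableGeomSeries R]
    {x : R} {n : ℕ} (h : ‖x ^ n‖ < 1) : IsUnit (1 - x) := by
  have hu : IsUnit (1 - x ^ n) := isUnit_one_sub_of_norm_lt_one h
  rw [← mul_neg_geom_sum] at hu
  have hc : Commute (1 - x) (∑ i ∈ Finset.range n, x ^ i) :=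
    ((Commute.one_left _).sub_left (Commute.sum_right _ _ _ fun i _ => Commute.self_pow x i))
  exact (hc.isUnit_mul_iff.1 hu).1

/-- Ring inversion is differentiable at units, and the inverted operator is affine in `lam`. -/
theorem differentiable_inverse_one_sub_apply {E : Type*} [NormedAddCommGroup E] [NormedSpace ℂ E]
    [CompleteSpace E] (J Q : E →L[ℂ] E) (c : E)
    (h : ∀ lam : ℂ, IsUnit (1 - J * (Q - lam • J))) :
    Differentiable ℂ fun lam : ℂ => Ring.inverse (1 - J * (Q - lam • J)) c := by
  intro lam
  have h2 : DifferentiableAt ℂ (fun lam : ℂ => 1 - J * (Q - lam • J)) lam := by fun_prop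
  have h3 := (differentiableAt_inverse (𝕜 := ℂ) (h lam)).comp lam h2
  exact h3.clm_apply (differentiableAt_const _)

theorem differentiable_sub_smul_apply {E : Type*} [NormedAddCommGroup E] [NormedSpace ℂ E]
    (J Q : E →L[ℂ] E) {f : ℂ → E} (hf : Differentiable ℂ f) (c : E) :
    Differentiable ℂ fun lam : ℂ => c + (Q - lam • J) (f lam) :=
  (differentiable_const _).add (Differentiable.clm_apply (by fun_prop) hf)

/-- The operator `f ↦ ∫ₐˣ p f` on continuous functions. -/
noncomputable def primitiveOp (hab : a ≤ b) (p : ℝ → ℂ) (hp : IntervalIntegrable p volume a b) :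
    C(Set.Icc a b, ℂ) →L[ℂ] C(Set.Icc a b, ℂ) :=
  LinearMap.mkContinuous
    { toFun := fun f =>
        ⟨fun x => ∫ t in a..x, p t * Set.IccExtend hab f t,
          continuous_integral_mul_IccExtend hab hp f⟩
      map_add' := fun f g => by
        ext x
        change ∫ t in a..(x : ℝ), p t * Set.IccExtend hab (f + g) t =
          (∫ t in a..(x : ℝ), p t * Set.IccExtend hab f t) +
            ∫ t in a..(x : ℝ), p t * Set.IccExtend hab g t
        rw [← intervalIntegral.integral_add
          (intervalIntegrable_mul_IccExtend hab hp f (Set.left_mem_Icc.2 hab) x.2)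
          (intervalIntegrable_mul_IccExtend hab hp g (Set.left_mem_Icc.2 hab) x.2)]
        congr 1
        ext t
        simp [Set.IccExtend, mul_add]
      map_smul' := fun c f => by
        ext x
        change ∫ t in a..(x : ℝ), p t * Set.IccExtend hab (c • f) t =
          c * ∫ t in a..(x : ℝ), p t * Set.IccExtend hab f t
        rw [← intervalIntegral.integral_const_mul]
        congr 1
        ext t
        simp [Set.IccExtend]
        ring }
    (∫ t in a..b, ‖p t‖) fun f => by
      rw [ContinuousMap.norm_le]
      · intro x
        exact norm_integral_mul_IccExtend_le hab hp f x.2 (norm_nonneg _)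
          fun t _ => f.norm_coe_le_norm t
      · exact mul_nonneg (intervalIntegral.integral_nonneg hab fun _ _ => norm_nonneg _)
          (norm_nonneg _)

theorem primitiveOp_apply (hab : a ≤ b) (p : ℝ → ℂ) (hp : IntervalIntegrable p volume a b)
    (f : C(Set.Icc a b, ℂ)) (x : Set.Icc a b) :
    primitiveOp hab p hp f x = ∫ t in a..x, p t * Set.IccExtend hab f t := rfl

/-- Each application costs a factor `∫ ‖p‖` for the inner primitive, and the outer one integrates
the previous power of `x - a`, which produces the factorial. -/
theorem norm_pow_primitiveOp_comp_le (hab : a ≤ b) {p : ℝ → ℂ}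
    (hp : IntervalIntegrable p volume a b) (h1 : IntervalIntegrable (fun _ => (1 : ℂ)) volume a b)
    (n : ℕ) (f : C(Set.Icc a b, ℂ)) (x : Set.Icc a b) :
    ‖((primitiveOp hab _ h1 * primitiveOp hab p hp) ^ n) f x‖ ≤
      ‖f‖ * (∫ t in a..b, ‖p t‖) ^ n * ((x - a) ^ n / n.factorial) := by
  have hK : 0 ≤ ∫ t in a..b, ‖p t‖ :=
    intervalIntegral.integral_nonneg hab fun _ _ => norm_nonneg _
  set K := ∫ t in a..b, ‖p t‖ with hKdef
  induction n generalizing x with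
  | zero => simpa using f.norm_coe_le_norm x
  | succ n ih =>
    rw [pow_succ', mul_apply_eq_comp, mul_apply_eq_comp]
    set g := ((primitiveOp hab _ h1 * primitiveOp hab p hp) ^ n) f with hg
    have hpg : ∀ s : Set.Icc a b, ‖primitiveOp hab p hp g s‖ ≤
        K * (‖f‖ * K ^ n * ((s - a) ^ n / n.factorial)) := by
      intro s
      have hs0 : 0 ≤ (s : ℝ) - a := sub_nonneg.2 s.2.1
      refine norm_integral_mul_IccExtend_le hab hp g s.2 (by positivity) fun t ht => ?_
      refine (ih t).trans ?_
      have := t.2.1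
      gcongr
    rw [primitiveOp_apply]
    have h2 : ‖∫ t in a..x, (1 : ℂ) * Set.IccExtend hab (primitiveOp hab p hp g) t‖ ≤
        ∫ t in a..x, K * (‖f‖ * K ^ n * ((t - a) ^ n / n.factorial)) := by
      refine intervalIntegral.norm_integral_le_of_norm_le x.2.1 (ae_of_all _ fun t ht => ?_)
        (Continuous.intervalIntegrable (by fun_prop) _ _)
      have htm : t ∈ Set.Icc a b := ⟨ht.1.le, ht.2.trans x.2.2⟩
      rw [one_mul, Set.IccExtend_of_mem _ _ htm]
      exact hpg ⟨t, htm⟩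
    refine h2.trans (le_of_eq ?_)
    simp only [intervalIntegral.integral_const_mul, intervalIntegral.integral_div]
    rw [intervalIntegral.integral_comp_sub_right (fun t => t ^ n), integral_pow,
      Nat.factorial_succ]
    push_cast
    simp
    field_simp
    ring

theorem isUnit_one_sub_primitiveOp_comp (hab : a ≤ b) {p : ℝ → ℂ}
    (hp : IntervalIntegrable p volume a b)
    (h1 : IntervalIntegrable (fun _ => (1 : ℂ)) volume a b) :
    IsUnit (1 - primitiveOp hab _ h1 * primitiveOp hab p hp) := by
  set A := primitiveOp hab _ h1 * primitiveOp hab p hp with hA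
  have hK : 0 ≤ ∫ t in a..b, ‖p t‖ :=
    intervalIntegral.integral_nonneg hab fun _ _ => norm_nonneg _
  have hb0 : 0 ≤ b - a := sub_nonneg.2 hab
  have hn : ∀ n : ℕ, ‖A ^ n‖ ≤ ((∫ t in a..b, ‖p t‖) * (b - a)) ^ n / n.factorial := by
    intro n
    refine ContinuousLinearMap.opNorm_le_bound _ (by positivity) fun f => ?_
    rw [ContinuousMap.norm_le _ (by positivity)]
    intro x
    refine (norm_pow_primitiveOp_comp_le hab hp h1 n f x).trans ?_
    have hx0 : 0 ≤ (x : ℝ) - a := sub_nonneg.2 x.2.1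
    have hxb := x.2.2
    rw [mul_pow]
    calc _ ≤ ‖f‖ * (∫ t in a..b, ‖p t‖) ^ n * ((b - a) ^ n / n.factorial) := by gcongr
      _ = _ := by ring
  -- The factorial beats the power, so some iterate is a strict contraction with no smallness
  -- assumed of `p` or `b - a`.
  obtain ⟨n, hlt⟩ := ((FloorSemiring.tendsto_pow_div_factorial_atTop
    ((∫ t in a..b, ‖p t‖) * (b - a))).eventually (gt_mem_nhds one_pos)).exists
  exact isUnit_one_sub_of_norm_pow_lt_one (R := C(Set.Icc a b, ℂ) →L[ℂ] C(Set.Icc a b, ℂ))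
    (n := n) ((hn n).trans_lt hlt)

/-- Solutions of the initial value problem at `a` exist on `[a, b]` for every spectral parameter,
and their values are entire functions of it. -/
theorem exists_solvesOn {q : ℝ → ℝ} (hab : a ≤ b) (hq : IntervalIntegrable q volume a b)
    (y₀ y₁ : ℂ) : ∃ y dy : ℂ → ℝ → ℂ,
      (∀ lam, SolvesOn q lam a b (y lam) (dy lam) ∧ y lam a = y₀ ∧ dy lam a = y₁) ∧
      ∀ x ∈ Set.Icc a b, (Differentiable ℂ fun lam => y lam x) ∧
        Differentiable ℂ fun lam => dy lam x := by
  have h1 : IntervalIntegrable (fun _ => (1 : ℂ)) volume a b := by simp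
  have hqc : IntervalIntegrable (fun t => (q t : ℂ)) volume a b :=
    ⟨hq.1.ofReal, hq.2.ofReal⟩
  have hqp : ∀ lam : ℂ, IntervalIntegrable (fun t => (q t : ℂ) - lam) volume a b := fun lam =>
    hqc.sub (by simp)
  set J := primitiveOp hab _ h1 with hJ
  set Q := primitiveOp hab _ hqc with hQ
  have hT : ∀ lam : ℂ, Q - lam • J = primitiveOp hab _ (hqp lam) := by
    intro lam
    ext f x
    simp only [sub_apply, smul_apply,
      ContinuousMap.sub_apply, ContinuousMap.smul_apply, hJ, hQ, primitiveOp_apply, smul_eq_mul]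
    rw [← intervalIntegral.integral_const_mul, ← intervalIntegral.integral_sub
      (intervalIntegrable_mul_IccExtend hab hqc f (Set.left_mem_Icc.2 hab) x.2)
      ((intervalIntegrable_mul_IccExtend hab h1 f (Set.left_mem_Icc.2 hab) x.2).const_mul _)]
    congr 1
    ext t
    ring
  -- The initial value problem is the system `f = y₀ + J g`, `g = y₁ + (Q - lam J) f`. Eliminating
  -- `g` leaves `(1 - J (Q - lam J)) f = c₀`.
  set c₀ : C(Set.Icc a b, ℂ) := ContinuousMap.const _ y₀ + J (ContinuousMap.const _ y₁) with hc₀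
  set f : ℂ → C(Set.Icc a b, ℂ) := fun lam => Ring.inverse (1 - J * (Q - lam • J)) c₀ with hf
  set g : ℂ → C(Set.Icc a b, ℂ) :=
    fun lam => ContinuousMap.const _ y₁ + (Q - lam • J) (f lam) with hg
  have hunit : ∀ lam : ℂ, IsUnit (1 - J * (Q - lam • J)) := fun lam => by
    rw [hT]; exact isUnit_one_sub_primitiveOp_comp hab (hqp lam) h1
  have hfg : ∀ lam, f lam = ContinuousMap.const _ y₀ + J (g lam) := by
    intro lam
    have h := congrArg (fun T => T c₀) (Ring.mul_inverse_cancel _ (hunit lam))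
    simp only [mul_apply_eq_comp, one_apply_eq_self,
      sub_apply (1 : _ →L[ℂ] _)] at h
    change f lam - J ((Q - lam • J) (f lam)) = c₀ at h
    rw [hg, map_add, ← add_assoc, ← hc₀, ← h, sub_add_cancel]
  have hdf : Differentiable ℂ f := differentiable_inverse_one_sub_apply J Q c₀ hunit
  have hdg : Differentiable ℂ g := differentiable_sub_smul_apply J Q hdf _
  have heval : ∀ (x : Set.Icc a b) (F : ℂ → C(Set.Icc a b, ℂ)), Differentiable ℂ F →
      Differentiable ℂ fun lam => F lam x := fun x F hF =>
    (ContinuousMap.evalCLM ℂ x : C(Set.Icc a b, ℂ) →L[ℂ] ℂ).differentiable.comp hF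
  have hgx : ∀ lam x (hx : x ∈ Set.Icc a b), g lam ⟨x, hx⟩ = y₁ + ∫ t in a..x,
      ((q t : ℂ) - lam) * Set.IccExtend hab (f lam) t := fun lam x hx => by
    change y₁ + (Q - lam • J) (f lam) ⟨x, hx⟩ = _
    rw [hT, primitiveOp_apply]
  refine ⟨fun lam => Set.IccExtend hab (f lam), fun lam => Set.IccExtend hab (g lam),
    fun lam => ⟨⟨fun x hx => ?_, ?_, ?_⟩, ?_, ?_⟩, fun x hx => ⟨?_, ?_⟩⟩
  · have hcont : Continuous (Set.IccExtend hab (g lam)) := (g lam).continuous.Icc_extend'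
    have h2 : HasDerivAt (fun x => y₀ + ∫ t in a..x, Set.IccExtend hab (g lam) t)
        (Set.IccExtend hab (g lam) x) x :=
      (hcont.integral_hasStrictDerivAt a x).hasDerivAt.const_add _
    refine h2.hasDerivWithinAt.congr_of_mem (fun s hs => ?_) hx
    change Set.IccExtend hab (f lam) s = _
    rw [Set.IccExtend_of_mem _ _ hs, hfg]
    simp [hJ, primitiveOp_apply]
  · have hI := intervalIntegrable_mul_IccExtend hab (hqp lam) (f lam) (Set.left_mem_Icc.2 hab)
      (Set.right_mem_Icc.2 hab)
    refine (hI.absolutelyContinuousOnInterval_primitive (c := a) (by simp)).of_dist_le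
      fun s hs t ht => ?_
    rw [Set.uIcc_of_le hab] at hs ht
    beta_reduce
    rw [Set.IccExtend_of_mem _ _ hs, Set.IccExtend_of_mem _ _ ht, hgx, hgx, dist_add_left]
  · have hI := intervalIntegrable_mul_IccExtend hab (hqp lam) (f lam) (Set.left_mem_Icc.2 hab)
      (Set.right_mem_Icc.2 hab)
    filter_upwards [ae_mem_Ioo_of_restrict_Icc a b, ae_restrict_of_ae hI.ae_hasDerivAt_integral]
      with x hx hd
    refine ⟨((q x : ℂ) - lam) * Set.IccExtend hab (f lam) x, ?_, by ring⟩
    have hxm : x ∈ Set.uIcc a b := by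
      rw [Set.uIcc_of_le hab]; exact Set.Ioo_subset_Icc_self hx
    refine ((hd hxm a (by simp)).const_add y₁).congr_of_eventuallyEq ?_
    filter_upwards [Icc_mem_nhds hx.1 hx.2] with s hs
    rw [Set.IccExtend_of_mem _ _ hs, hgx]
  · beta_reduce
    rw [Set.IccExtend_of_mem _ _ (Set.left_mem_Icc.2 hab), hfg]
    simp [hJ, primitiveOp_apply]
  · beta_reduce
    rw [Set.IccExtend_of_mem _ _ (Set.left_mem_Icc.2 hab), hgx]
    simp
  · simp_rw [Set.IccExtend_of_mem hab _ hx]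
    exact heval _ f hdf
  · simp_rw [Set.IccExtend_of_mem hab _ hx]
    exact heval _ g hdg

end TransferSL

/-! ### Splitting Cauchy data into exponential modes, with estimates for large `κ`. -/

namespace TransferSL

/-- The coefficient of the growing exponential in the Cauchy data `(y, y')`, for the spectral
parameter `-κ ^ 2`. -/
noncomputable def growing (κ y dy : ℂ) : ℂ := (y + dy / κ) / 2

/-- The coefficient of the decaying exponential in the Cauchy data `(y, y')`, for the spectral
parameter `-κ ^ 2`. -/
noncomputable def decaying (κ y dy : ℂ) : ℂ := (y - dy / κ) / 2

theorem growing_add_decaying (κ y dy : ℂ) : growing κ y dy + decaying κ y dy = y := by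
  unfold growing decaying; ring

theorem mul_growing_sub_decaying {κ : ℂ} (hκ : κ ≠ 0) (y dy : ℂ) :
    κ * (growing κ y dy - decaying κ y dy) = dy := by
  unfold growing decaying; field_simp; ring

/-- Since `-κ ^ 2` is even in `κ`, this symmetry transfers every estimate for the growing part to
the decaying part. -/
theorem decaying_eq_growing_neg (κ y dy : ℂ) : decaying κ y dy = growing (-κ) y dy := by
  unfold growing decaying; rw [div_neg]; ring

variable {q : ℝ → ℝ} {κ : ℂ} {a b : ℝ} {y dy : ℝ → ℂ}

/-- Variation of constants: the growing part `P` satisfies `P' = κ P + q y / (2κ)` almost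
everywhere, and `exp (-κ (x - a))` is an integrating factor. -/
theorem SolvesOn.growing_eq (h : SolvesOn q (-κ ^ 2) a b y dy) (hκ : κ ≠ 0) (hab : a ≤ b)
    (hq : IntervalIntegrable q volume a b) {x : ℝ} (hx : x ∈ Set.Icc a b) :
    growing κ (y x) (dy x) = Complex.exp (κ * (x - a)) * growing κ (y a) (dy a) +
      ∫ t in a..x, Complex.exp (κ * (x - t)) * (q t * y t / (2 * κ)) := by
  set E : ℝ → ℂ := fun x => Complex.exp (-κ * (x - a)) with hE
  have hEd : ∀ x, HasDerivAt E (-κ * E x) x := fun x => by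
    have h1 : HasDerivAt (fun x : ℝ => -κ * ((x : ℂ) - a)) (-κ) x := by
      simpa using (((Complex.ofRealCLM.hasDerivAt (x := x)).sub_const (a : ℂ)).const_mul (-κ))
    refine h1.cexp.congr_deriv ?_
    rw [hE]; ring
  have hEc : Continuous E := by rw [hE]; fun_prop
  have hEac : AbsolutelyContinuousOnInterval E a b :=
    absolutelyContinuousOnInterval_of_hasDerivWithinAt hab
      (fun x _ => (hEd x).hasDerivWithinAt) (by fun_prop)
  have hac : AbsolutelyContinuousOnInterval
      (fun x => E x * ((1 / 2 : ℂ) * y x + (1 / (2 * κ)) * dy x)) a b :=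
    hEac.smul (((h.absCont_fun hab).const_smul (1 / 2 : ℂ)).add
      (h.absCont.const_smul (1 / (2 * κ))))
  have hg : ∀ x, growing κ (y x) (dy x) = (1 / 2 : ℂ) * y x + (1 / (2 * κ)) * dy x := fun x => by
    unfold growing; field_simp
  have hint : IntervalIntegrable (fun t => E t * (q t * y t / (2 * κ))) volume a b := by
    have hqc : IntervalIntegrable (fun t => (q t : ℂ)) volume a b := ⟨hq.1.ofReal, hq.2.ofReal⟩
    have hyc := h.continuousOn
    rw [← Set.uIcc_of_le hab] at hyc
    exact ((hqc.mul_continuousOn hyc).div_const _).continuousOn_mul hEc.continuousOn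
  have hmain := hac.eq_add_integral hab hint (by
    filter_upwards [h.ae_hasDerivAt] with x ⟨h1, h2⟩
    refine ((hEd x).mul ((h1.const_mul (1 / 2 : ℂ)).add
      (h2.const_mul (1 / (2 * κ))))).congr_deriv ?_
    simp only [Pi.add_apply]
    field_simp
    ring) x hx
  have hEa : E a = 1 := by simp [hE]
  have hexp : Complex.exp (κ * (x - a)) * E x = 1 := by
    rw [hE, ← Complex.exp_add]; simp
  rw [hEa, one_mul, ← hg, ← hg] at hmain
  have h3 := congrArg (Complex.exp (κ * (x - a)) * ·) hmain
  simp only [← mul_assoc, hexp, one_mul, mul_add] at h3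
  rw [h3, ← intervalIntegral.integral_const_mul]
  congr 1
  refine intervalIntegral.integral_congr fun t _ => ?_
  simp only [hE, ← mul_assoc, ← Complex.exp_add]
  congr 4
  ring

theorem norm_exp_mul_le (κ : ℂ) {s : ℝ} (hs : 0 ≤ s) :
    ‖Complex.exp (κ * s)‖ ≤ Real.exp (|κ.re| * s) := by
  rw [Complex.norm_exp]
  gcongr
  simp only [Complex.mul_re, Complex.ofReal_re, Complex.ofReal_im, mul_zero, sub_zero]
  gcongr
  exact le_abs_self _

/-- If `y` is bounded by `m exp (|Re κ| (x - a))`, the growing part is close to that of the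
unperturbed equation. -/
theorem SolvesOn.norm_growing_sub_le_of_bound (h : SolvesOn q (-κ ^ 2) a b y dy) (hκ : κ ≠ 0)
    (hab : a ≤ b) (hq : IntervalIntegrable q volume a b) {m : ℝ}
    (hm : ∀ x ∈ Set.Icc a b, ‖y x‖ ≤ m * Real.exp (|κ.re| * (x - a))) {x : ℝ}
    (hx : x ∈ Set.Icc a b) :
    ‖growing κ (y x) (dy x) - Complex.exp (κ * (x - a)) * growing κ (y a) (dy a)‖ ≤
      (∫ t in a..b, |q t|) / (2 * ‖κ‖) * m * Real.exp (|κ.re| * (x - a)) := by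
  have hκ0 : 0 < ‖κ‖ := norm_pos_iff.2 hκ
  have hm0 : 0 ≤ m := by
    have := (norm_nonneg _).trans (hm a (Set.left_mem_Icc.2 hab))
    simpa using this
  rw [h.growing_eq hκ hab hq hx, add_sub_cancel_left]
  have hsub : Set.uIcc a x ⊆ Set.uIcc a b := by
    rw [Set.uIcc_of_le hab, Set.uIcc_of_le hx.1]; exact Set.Icc_subset_Icc_right hx.2
  have h1 : ‖∫ t in a..x, Complex.exp (κ * (x - t)) * (q t * y t / (2 * κ))‖ ≤
      ∫ t in a..x, |q t| * (m * Real.exp (|κ.re| * (x - a)) / (2 * ‖κ‖)) := by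
    refine intervalIntegral.norm_integral_le_of_norm_le hx.1 (ae_of_all _ fun t ht => ?_)
      ((hq.norm.mono_set hsub).mul_const _)
    have htm : t ∈ Set.Icc a b := ⟨ht.1.le, ht.2.trans hx.2⟩
    have h2 := norm_exp_mul_le κ (sub_nonneg.2 ht.2)
    have h3 := hm t htm
    push_cast at h2
    rw [norm_mul, norm_div, norm_mul, norm_mul, Complex.norm_real, Complex.norm_two,
      Real.norm_eq_abs]
    calc _ ≤ Real.exp (|κ.re| * (x - t)) *
          (|q t| * (m * Real.exp (|κ.re| * (t - a))) / (2 * ‖κ‖)) := by gcongr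
      _ = |q t| * (m * (Real.exp (|κ.re| * (x - t)) * Real.exp (|κ.re| * (t - a))) /
          (2 * ‖κ‖)) := by ring
      _ = _ := by rw [← Real.exp_add]; ring_nf
  refine h1.trans ?_
  rw [intervalIntegral.integral_mul_const]
  calc _ ≤ (∫ t in a..b, |q t|) * (m * Real.exp (|κ.re| * (x - a)) / (2 * ‖κ‖)) := by
        gcongr
        exact intervalIntegral.integral_mono_interval le_rfl hx.1 hx.2
          (ae_of_all _ fun t => abs_nonneg _) hq.norm
    _ = _ := by ring

/-- A bootstrap: let `m` be the maximum of `‖y‖` weighted by `exp (-|Re κ| (x - a))`. The two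
perturbation errors at a maximum point contribute at most `m / 4` each, so together `m / 2`, which
is absorbed on the left. -/
theorem SolvesOn.norm_le (h : SolvesOn q (-κ ^ 2) a b y dy) (hκ : κ ≠ 0) (hab : a ≤ b)
    (hq : IntervalIntegrable q volume a b) (hκq : 2 * ∫ t in a..b, |q t| ≤ ‖κ‖)
    {x : ℝ} (hx : x ∈ Set.Icc a b) :
    ‖y x‖ ≤ 2 * (‖growing κ (y a) (dy a)‖ + ‖decaying κ (y a) (dy a)‖) *
      Real.exp (|κ.re| * (x - a)) := by
  have hκ0 : 0 < ‖κ‖ := norm_pos_iff.2 hκ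
  have hcont : ContinuousOn (fun x => ‖y x‖ * Real.exp (-(|κ.re| * (x - a)))) (Set.Icc a b) :=
    h.continuousOn.norm.mul (by fun_prop)
  obtain ⟨x₀, hx₀, hmax⟩ := isCompact_Icc.exists_isMaxOn (Set.nonempty_Icc.2 hab) hcont
  set m := ‖y x₀‖ * Real.exp (-(|κ.re| * (x₀ - a))) with hm
  have hbound : ∀ x ∈ Set.Icc a b, ‖y x‖ ≤ m * Real.exp (|κ.re| * (x - a)) := by
    intro x hx
    have h1 : ‖y x‖ * Real.exp (-(|κ.re| * (x - a))) ≤ m := hmax hx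
    rwa [Real.exp_neg, ← div_eq_mul_inv, div_le_iff₀ (Real.exp_pos _)] at h1
  suffices hm2 : m ≤ 2 * (‖growing κ (y a) (dy a)‖ + ‖decaying κ (y a) (dy a)‖) from
    (hbound x hx).trans (by gcongr)
  have hx₀' := sub_nonneg.2 hx₀.1
  have hP := h.norm_growing_sub_le_of_bound hκ hab hq hbound hx₀
  have h' : SolvesOn q (-(-κ) ^ 2) a b y dy := by rwa [neg_sq]
  have hN := h'.norm_growing_sub_le_of_bound (neg_ne_zero.2 hκ) hab hq
    (by simpa using hbound) hx₀
  simp only [← decaying_eq_growing_neg, norm_neg, Complex.neg_re, abs_neg] at hN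
  have e1 := norm_exp_mul_le κ hx₀'
  have e2 := norm_exp_mul_le (-κ) hx₀'
  simp only [Complex.neg_re, abs_neg] at e2
  push_cast at e1 e2
  set E := Real.exp (|κ.re| * (x₀ - a)) with hE
  have hE0 : 0 < E := Real.exp_pos _
  have hm0 : 0 ≤ m := by positivity
  have hy : ‖y x₀‖ = m * E := by
    rw [hm, mul_assoc, ← Real.exp_add]; simp
  -- This is exactly the largeness condition `hκq` on `κ`.
  have hc : (∫ t in a..b, |q t|) / (2 * ‖κ‖) ≤ 1 / 4 := by
    rw [div_le_iff₀ (by positivity)]; linarith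
  have hP' : ‖growing κ (y x₀) (dy x₀)‖ ≤ E * ‖growing κ (y a) (dy a)‖ + 1 / 4 * m * E := by
    have h1 := norm_le_norm_add_norm_sub' (growing κ (y x₀) (dy x₀))
      (Complex.exp (κ * (x₀ - a)) * growing κ (y a) (dy a))
    rw [norm_mul] at h1
    refine h1.trans (add_le_add (by gcongr) (hP.trans (by gcongr)))
  have hN' : ‖decaying κ (y x₀) (dy x₀)‖ ≤ E * ‖decaying κ (y a) (dy a)‖ + 1 / 4 * m * E := by
    have h1 := norm_le_norm_add_norm_sub' (decaying κ (y x₀) (dy x₀))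
      (Complex.exp (-κ * (x₀ - a)) * decaying κ (y a) (dy a))
    rw [norm_mul] at h1
    refine h1.trans (add_le_add (by gcongr) (hN.trans (by gcongr)))
  have hsum := norm_add_le (growing κ (y x₀) (dy x₀)) (decaying κ (y x₀) (dy x₀))
  rw [growing_add_decaying, hy] at hsum
  have : m * E ≤ (‖growing κ (y a) (dy a)‖ + ‖decaying κ (y a) (dy a)‖ + m / 2) * E := by
    linarith
  have := le_of_mul_le_mul_right this hE0
  linarith

theorem SolvesOn.norm_growing_sub_le (h : SolvesOn q (-κ ^ 2) a b y dy) (hκ : κ ≠ 0)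
    (hab : a ≤ b) (hq : IntervalIntegrable q volume a b)
    (hκq : 2 * ∫ t in a..b, |q t| ≤ ‖κ‖) {x : ℝ} (hx : x ∈ Set.Icc a b) :
    ‖growing κ (y x) (dy x) - Complex.exp (κ * (x - a)) * growing κ (y a) (dy a)‖ ≤
      (∫ t in a..b, |q t|) / ‖κ‖ *
        (‖growing κ (y a) (dy a)‖ + ‖decaying κ (y a) (dy a)‖) * Real.exp (|κ.re| * (x - a)) := by
  have hκ0 : 0 < ‖κ‖ := norm_pos_iff.2 hκ
  refine (h.norm_growing_sub_le_of_bound hκ hab hq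
    (fun x hx => h.norm_le hκ hab hq hκq hx) hx).trans (le_of_eq ?_)
  field_simp

theorem SolvesOn.norm_decaying_sub_le (h : SolvesOn q (-κ ^ 2) a b y dy) (hκ : κ ≠ 0)
    (hab : a ≤ b) (hq : IntervalIntegrable q volume a b)
    (hκq : 2 * ∫ t in a..b, |q t| ≤ ‖κ‖) {x : ℝ} (hx : x ∈ Set.Icc a b) :
    ‖decaying κ (y x) (dy x) - Complex.exp (-κ * (x - a)) * decaying κ (y a) (dy a)‖ ≤
      (∫ t in a..b, |q t|) / ‖κ‖ *
        (‖growing κ (y a) (dy a)‖ + ‖decaying κ (y a) (dy a)‖) * Real.exp (|κ.re| * (x - a)) := by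
  have h' : SolvesOn q (-(-κ) ^ 2) a b y dy := by rwa [neg_sq]
  have := h'.norm_growing_sub_le (neg_ne_zero.2 hκ) hab hq (by simpa using hκq) hx
  simpa only [decaying_eq_growing_neg, norm_neg, Complex.neg_re, abs_neg, neg_neg,
    add_comm ‖growing (-κ) _ _‖] using this

end TransferSL

/-! ### Exponential growth in `κ`, and a Phragmén–Lindelöf argument. -/

namespace TransferSL

/-- The function `f` grows at most exponentially: it is `O(exp (B ‖κ‖))` for some `B`. -/
def ExpGrowth (f : ℂ → ℂ) : Prop :=
  ∃ B : ℝ, 0 ≤ B ∧ f =O[Bornology.cobounded ℂ] fun κ => Real.exp (B * ‖κ‖)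

theorem ExpGrowth.mono_exp {f : ℂ → ℂ} {B B' : ℝ} (hB : B ≤ B')
    (h : f =O[Bornology.cobounded ℂ] fun κ => Real.exp (B * ‖κ‖)) :
    f =O[Bornology.cobounded ℂ] fun κ => Real.exp (B' * ‖κ‖) := by
  refine h.trans (Asymptotics.IsBigO.of_bound 1 (Eventually.of_forall fun κ => ?_))
  rw [Real.norm_of_nonneg (Real.exp_pos _).le, Real.norm_of_nonneg (Real.exp_pos _).le, one_mul]
  gcongr

theorem ExpGrowth.add {f g : ℂ → ℂ} (hf : ExpGrowth f) (hg : ExpGrowth g) :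
    ExpGrowth fun κ => f κ + g κ := by
  obtain ⟨B, hB, h⟩ := hf
  obtain ⟨B', hB', h'⟩ := hg
  exact ⟨max B B', le_max_of_le_left hB,
    (ExpGrowth.mono_exp (le_max_left _ _) h).add (ExpGrowth.mono_exp (le_max_right _ _) h')⟩

theorem ExpGrowth.mul {f g : ℂ → ℂ} (hf : ExpGrowth f) (hg : ExpGrowth g) :
    ExpGrowth fun κ => f κ * g κ := by
  obtain ⟨B, hB, h⟩ := hf
  obtain ⟨B', hB', h'⟩ := hg
  refine ⟨B + B', add_nonneg hB hB', (h.mul h').congr_right fun κ => ?_⟩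
  rw [← Real.exp_add, add_mul]

theorem ExpGrowth.const (c : ℂ) : ExpGrowth fun _ => c :=
  ⟨0, le_rfl, by simpa using Asymptotics.isBigO_const_const c (one_ne_zero (α := ℝ)) _⟩

theorem ExpGrowth.id : ExpGrowth fun κ => κ := by
  refine ⟨1, zero_le_one, Asymptotics.IsBigO.of_bound 1 (Eventually.of_forall fun κ => ?_)⟩
  rw [Real.norm_of_nonneg (Real.exp_pos _).le, one_mul, one_mul]
  linarith [Real.add_one_le_exp ‖κ‖]

theorem ExpGrowth.inv : ExpGrowth fun κ => κ⁻¹ := by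
  refine ⟨0, le_rfl, ?_⟩
  simp only [zero_mul, Real.exp_zero]
  exact tendsto_inv₀_cobounded.isBigO_one ℝ

theorem ExpGrowth.neg {f : ℂ → ℂ} (hf : ExpGrowth f) : ExpGrowth fun κ => -f κ := by
  simpa using (ExpGrowth.const (-1)).mul hf

theorem ExpGrowth.sub {f g : ℂ → ℂ} (hf : ExpGrowth f) (hg : ExpGrowth g) :
    ExpGrowth fun κ => f κ - g κ := by
  simpa [sub_eq_add_neg] using hf.add hg.neg

theorem ExpGrowth.growing {y dy : ℂ → ℂ} (hy : ExpGrowth y) (hdy : ExpGrowth dy) :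
    ExpGrowth fun κ => growing κ (y κ) (dy κ) := by
  simpa [TransferSL.growing, div_eq_mul_inv] using
    (hy.add (hdy.mul ExpGrowth.inv)).mul (ExpGrowth.const 2⁻¹)

theorem ExpGrowth.decaying {y dy : ℂ → ℂ} (hy : ExpGrowth y) (hdy : ExpGrowth dy) :
    ExpGrowth fun κ => decaying κ (y κ) (dy κ) := by
  simpa [TransferSL.decaying, div_eq_mul_inv] using
    (hy.sub (hdy.mul ExpGrowth.inv)).mul (ExpGrowth.const 2⁻¹)

theorem ExpGrowth.norm {f : ℂ → ℂ} (hf : ExpGrowth f) : ExpGrowth fun κ => (‖f κ‖ : ℂ) := by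
  obtain ⟨B, hB, h⟩ := hf
  refine ⟨B, hB, ?_⟩
  rw [← Asymptotics.isBigO_norm_left] at h ⊢
  simpa using h

theorem ExpGrowth.of_norm_le {f g : ℂ → ℂ} (hg : ExpGrowth g)
    (h : ∀ᶠ κ in Bornology.cobounded ℂ, ‖f κ‖ ≤ ‖g κ‖) : ExpGrowth f := by
  obtain ⟨B, hB, hB'⟩ := hg
  exact ⟨B, hB, (Asymptotics.IsBigO.of_bound 1 (by simpa using h)).trans hB'⟩

theorem ExpGrowth.exp {c : ℝ} (hc : 0 ≤ c) : ExpGrowth fun κ => (Real.exp (c * ‖κ‖) : ℂ) :=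
  ⟨c, hc, Asymptotics.IsBigO.of_bound 1 (Eventually.of_forall fun κ => by
    rw [Complex.norm_real, one_mul])⟩

theorem eventually_cobounded_le_norm (C : ℝ) :
    ∀ᶠ κ in Bornology.cobounded ℂ, κ ≠ 0 ∧ C ≤ ‖κ‖ := by
  filter_upwards [tendsto_norm_cobounded_atTop.eventually_ge_atTop C,
    tendsto_norm_cobounded_atTop.eventually_gt_atTop 0] with κ h1 h2
  exact ⟨norm_pos_iff.1 h2, h1⟩

variable {q : ℝ → ℝ} {a b : ℝ} {y dy : ℂ → ℝ → ℂ}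

/-- Each mode differs from its free evolution by an error of exponential size once `‖κ‖ ≥ 2 ∫ |q|`.
The value and derivative are then recombined from the two modes. -/
theorem ExpGrowth.solvesOn (hab : a ≤ b) (hq : IntervalIntegrable q volume a b)
    (h : ∀ κ, SolvesOn q (-κ ^ 2) a b (y κ) (dy κ))
    (hy : ExpGrowth fun κ => y κ a) (hdy : ExpGrowth fun κ => dy κ a) {x : ℝ}
    (hx : x ∈ Set.Icc a b) : ExpGrowth (fun κ => y κ x) ∧ ExpGrowth fun κ => dy κ x := by
  have hx' := sub_nonneg.2 hx.1
  have hP := hy.growing hdy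
  have hN := hy.decaying hdy
  have hE := ExpGrowth.exp hx'
  have hA : ExpGrowth fun κ => (((1 : ℝ) * (‖TransferSL.growing κ (y κ a) (dy κ a)‖ +
      ‖TransferSL.decaying κ (y κ a) (dy κ a)‖) * Real.exp ((x - a) * ‖κ‖) : ℝ) : ℂ) := by
    have := ((ExpGrowth.const 1).mul (hP.norm.add hN.norm)).mul hE
    simpa using this
  have hexp : ∀ κ : ℂ, Real.exp (|κ.re| * (x - a)) ≤ Real.exp ((x - a) * ‖κ‖) := fun κ => by
    rw [mul_comm]
    gcongr
    exact Complex.abs_re_le_norm κ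
  have key : ∀ κ : ℂ, κ ≠ 0 → 2 * ∫ t in a..b, |q t| ≤ ‖κ‖ →
      (∫ t in a..b, |q t|) / ‖κ‖ *
        (‖TransferSL.growing κ (y κ a) (dy κ a)‖ + ‖TransferSL.decaying κ (y κ a) (dy κ a)‖) *
        Real.exp (|κ.re| * (x - a)) ≤ 1 *
        (‖TransferSL.growing κ (y κ a) (dy κ a)‖ + ‖TransferSL.decaying κ (y κ a) (dy κ a)‖) *
        Real.exp ((x - a) * ‖κ‖) := by
    intro κ hκ hκq
    have hI : 0 ≤ ∫ t in a..b, |q t| := intervalIntegral.integral_nonneg hab fun _ _ => abs_nonneg _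
    have h1 : (∫ t in a..b, |q t|) / ‖κ‖ ≤ 1 := by
      rw [div_le_one (norm_pos_iff.2 hκ)]; linarith
    have := hexp κ
    gcongr
  have hexpg : ∀ s : ℂ, ‖s‖ ≤ 1 → ExpGrowth fun κ => Complex.exp (s * κ * (x - a)) := by
    intro s hs
    refine hE.of_norm_le (Eventually.of_forall fun κ => ?_)
    rw [Complex.norm_real, Real.norm_of_nonneg (Real.exp_pos _).le, Complex.norm_exp]
    gcongr
    refine (Complex.re_le_norm _).trans ?_
    rw [norm_mul, norm_mul, ← Complex.ofReal_sub, Complex.norm_real, Real.norm_of_nonneg hx',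
      mul_comm]
    gcongr
    exact mul_le_of_le_one_left (norm_nonneg _) hs
  have hP' : ExpGrowth fun κ => TransferSL.growing κ (y κ x) (dy κ x) := by
    have h1 : ExpGrowth fun κ => TransferSL.growing κ (y κ x) (dy κ x) -
        Complex.exp (κ * (x - a)) * TransferSL.growing κ (y κ a) (dy κ a) := by
      refine hA.of_norm_le ?_
      filter_upwards [eventually_cobounded_le_norm (2 * ∫ t in a..b, |q t|)] with κ ⟨hκ, hκq⟩
      rw [Complex.norm_real]
      exact (((h κ).norm_growing_sub_le hκ hab hq hκq hx).trans (key κ hκ hκq)).trans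
        (le_abs_self _)
    simpa using h1.add ((hexpg 1 (by simp)).mul hP)
  have hN' : ExpGrowth fun κ => TransferSL.decaying κ (y κ x) (dy κ x) := by
    have h1 : ExpGrowth fun κ => TransferSL.decaying κ (y κ x) (dy κ x) -
        Complex.exp (-κ * (x - a)) * TransferSL.decaying κ (y κ a) (dy κ a) := by
      refine hA.of_norm_le ?_
      filter_upwards [eventually_cobounded_le_norm (2 * ∫ t in a..b, |q t|)] with κ ⟨hκ, hκq⟩
      rw [Complex.norm_real]
      exact (((h κ).norm_decaying_sub_le hκ hab hq hκq hx).trans (key κ hκ hκq)).trans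
        (le_abs_self _)
    simpa using h1.add ((hexpg (-1) (by simp)).mul hN)
  constructor
  · simpa only [growing_add_decaying] using hP'.add hN'
  · refine (ExpGrowth.id.mul (hP'.sub hN')).of_norm_le ?_
    filter_upwards [eventually_cobounded_le_norm 0] with κ ⟨hκ, _⟩
    rw [mul_growing_sub_decaying hκ]

/-- An entire function of order `1 / 2` that tends to zero along two non-real rays vanishes. -/
theorem eq_zero_of_expGrowth_of_tendsto {F : ℂ → ℂ} (hF : Differentiable ℂ F)
    (hexp : ExpGrowth fun κ => F (-κ ^ 2))
    (hlim : Tendsto (fun κ => F (-κ ^ 2)) (comap Complex.re atTop) (𝓝 0)) : ∀ lam, F lam = 0 := by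
  -- With `κ = ω ζ`, the positive real and positive imaginary `ζ`-axes become the rays `s (1 - i)`
  -- and `s (1 + i)`, on both of which `Re κ = s → ∞`. Evenness of `h` covers the two negative
  -- half-axes.
  set ω : ℂ := 1 - Complex.I with hω
  set h : ℂ → ℂ := fun ζ => F (-(ω * ζ) ^ 2) with hh
  have hd : Differentiable ℂ h := hF.comp (by fun_prop)
  have heven : ∀ ζ, h (-ζ) = h ζ := fun ζ => by simp [hh]
  have hω0 : ω ≠ 0 := fun h0 => by
    have := congrArg Complex.re h0; simp [hω] at this
  have hray1 : Tendsto (fun s : ℝ => h s) atTop (𝓝 0) := by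
    refine hlim.comp (g := fun κ => F (-κ ^ 2)) (f := fun s : ℝ => ω * s) ?_
    rw [tendsto_comap_iff]
    convert tendsto_id using 1
    ext s
    simp [hω]
  have hray2 : Tendsto (fun s : ℝ => h (s * Complex.I)) atTop (𝓝 0) := by
    refine hlim.comp (g := fun κ => F (-κ ^ 2)) (f := fun s : ℝ => ω * (s * Complex.I)) ?_
    rw [tendsto_comap_iff]
    convert tendsto_id using 1
    ext s
    simp [hω]
  have hbdd : ∀ f : ℝ → ℂ, Continuous f → Tendsto f atTop (𝓝 0) → ∃ C, ∀ s, 0 ≤ s → ‖f s‖ ≤ C := by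
    intro f hf hlim
    obtain ⟨R, hR⟩ := eventually_atTop.1 
      (hlim.norm.eventually_le_const (u := 1) (by simp))
    obtain ⟨C, hC⟩ := (isCompact_Icc (a := 0) (b := R)).exists_bound_of_continuousOn hf.continuousOn
    refine ⟨max C 1, fun s hs => ?_⟩
    rcases le_total s R with hsR | hsR
    · exact le_max_of_le_left (hC s ⟨hs, hsR⟩)
    · exact le_max_of_le_right (hR s hsR)
  obtain ⟨C₁, hC₁⟩ := hbdd _ (hd.continuous.comp Complex.continuous_ofReal) hray1
  obtain ⟨C₂, hC₂⟩ := hbdd _ (hd.continuous.comp (by fun_prop :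
    Continuous fun s : ℝ => (s : ℂ) * Complex.I)) hray2
  set C := max C₁ C₂
  have hre : ∀ x : ℝ, ‖h x‖ ≤ C := fun x => by
    rcases le_total 0 x with hx | hx
    · exact (hC₁ x hx).trans (le_max_left _ _)
    · rw [← heven]
      have := hC₁ (-x) (neg_nonneg.2 hx)
      push_cast [Function.comp] at this
      exact this.trans (le_max_left _ _)
  have him : ∀ x : ℝ, ‖h (x * Complex.I)‖ ≤ C := fun x => by
    rcases le_total 0 x with hx | hx
    · exact (hC₂ x hx).trans (le_max_right _ _)
    · rw [← heven]
      have := hC₂ (-x) (neg_nonneg.2 hx)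
      push_cast [Function.comp] at this
      rw [neg_mul] at this
      exact this.trans (le_max_right _ _)
  obtain ⟨B, hB0, hB⟩ := hexp
  have hO : h =O[Bornology.cobounded ℂ] fun ζ => Real.exp (B * ‖ω‖ * ‖ζ‖ ^ (1 : ℝ)) := by
    have h1 : Tendsto (fun ζ => ω * ζ) (Bornology.cobounded ℂ) (Bornology.cobounded ℂ) := by
      rw [← tendsto_norm_atTop_iff_cobounded]
      simp_rw [norm_mul]
      exact tendsto_norm_cobounded_atTop.const_mul_atTop (norm_pos_iff.2 hω0)
    refine (hB.comp_tendsto h1).congr_right fun ζ => ?_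
    simp [mul_assoc]
  -- A quadrant admits growth of any order below 2, and `h` has order at most 1.
  have hO' : ∀ s : Set ℂ, ∃ c < (2 : ℝ), ∃ B,
      h =O[Bornology.cobounded ℂ ⊓ 𝓟 s] fun z => Real.exp (B * ‖z‖ ^ c) := fun s =>
    ⟨1, one_lt_two, _, hO.mono inf_le_left⟩
  have hall : ∀ z, ‖h z‖ ≤ C := by
    intro z
    rcases le_total 0 z.re with h1 | h1 <;> rcases le_total 0 z.im with h2 | h2
    · exact PhragmenLindelof.quadrant_I hd.diffContOnCl (hO' _) (fun x _ => hre x)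
        (fun x _ => him x) h1 h2
    · exact PhragmenLindelof.quadrant_IV hd.diffContOnCl (hO' _) (fun x _ => hre x)
        (fun x _ => him x) h1 h2
    · exact PhragmenLindelof.quadrant_II hd.diffContOnCl (hO' _) (fun x _ => hre x)
        (fun x _ => him x) h1 h2
    · exact PhragmenLindelof.quadrant_III hd.diffContOnCl (hO' _) (fun x _ => hre x)
        (fun x _ => him x) h1 h2
  have hconst : ∀ z, h z = h 0 := fun z =>
    hd.apply_eq_apply_of_bounded (isBounded_iff_forall_norm_le.2
      ⟨C, by rintro _ ⟨w, rfl⟩; exact hall w⟩) z 0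
  have hzero : h 0 = 0 := by
    refine tendsto_nhds_unique ?_ hray1
    simp_rw [fun s : ℝ => hconst s]
    exact tendsto_const_nhds
  intro lam
  obtain ⟨κ, hκ⟩ := IsAlgClosed.exists_pow_nat_eq (-lam) (n := 2) two_pos
  have := hconst (κ / ω)
  rw [hzero] at this
  simpa [hh, mul_div_cancel₀ _ hω0, hκ] using this

end TransferSL

/-! ### Leading asymptotics as `Re κ → ∞`. -/

namespace TransferSL

/-- The Cauchy data `(y, y')` (as functions of `κ`) have growing part asymptotic to `G` and
decaying part of at most the same size, as `Re κ → ∞`. -/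
structure GrowsLike (G y dy : ℂ → ℂ) : Prop where
  growing : Tendsto (fun κ => growing κ (y κ) (dy κ) / G κ) (comap Complex.re atTop) (𝓝 1)
  decaying : (fun κ => decaying κ (y κ) (dy κ) / G κ) =O[comap Complex.re atTop] fun _ => (1 : ℝ)

/-- The Cauchy data `(y, y')` (as functions of `κ`) have growing part asymptotic to `G` and
decaying part of smaller size, as `Re κ → ∞`. -/
structure PurelyGrowsLike (G y dy : ℂ → ℂ) : Prop where
  growing : Tendsto (fun κ => growing κ (y κ) (dy κ) / G κ) (comap Complex.re atTop) (𝓝 1)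
  decaying : Tendsto (fun κ => decaying κ (y κ) (dy κ) / G κ) (comap Complex.re atTop) (𝓝 0)

theorem tendsto_re_cobounded : Tendsto (fun κ : ℂ => κ) (comap Complex.re atTop)
    (Bornology.cobounded ℂ) := by
  rw [← tendsto_norm_atTop_iff_cobounded]
  exact tendsto_atTop_mono Complex.re_le_norm tendsto_comap

theorem tendsto_inv_re : Tendsto (fun κ : ℂ => κ⁻¹) (comap Complex.re atTop) (𝓝 0) :=
  tendsto_inv₀_cobounded.comp tendsto_re_cobounded

instance : (comap Complex.re atTop).NeBot :=
  comap_neBot_iff_frequently.2 (Eventually.frequently (Eventually.of_forall fun x => ⟨x, by simp⟩))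

theorem eventually_re (C : ℝ) : ∀ᶠ κ in comap Complex.re atTop, κ ≠ 0 ∧ 0 < κ.re ∧ C ≤ ‖κ‖ := by
  filter_upwards [tendsto_re_cobounded.eventually (eventually_cobounded_le_norm C),
    (tendsto_comap (f := Complex.re)).eventually_gt_atTop 0] with κ h1 h2
  exact ⟨h1.1, h2, h1.2⟩

/-- Up to elementary scaling, the factors from constant data, from the transfer matrix and from the
boundary form are all `A + B κ + C / κ`. Their size is governed by `B`, or by `A` if `B = 0`. -/
theorem tendsto_linear_div (A B C : ℂ) : Tendsto (fun κ : ℂ => (A + B * κ + C / κ) / κ)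
    (comap Complex.re atTop) (𝓝 B) := by
  have h1 : Tendsto (fun κ : ℂ => A * κ⁻¹ + B + C * (κ⁻¹ * κ⁻¹)) (comap Complex.re atTop)
      (𝓝 (A * 0 + B + C * (0 * 0))) :=
    ((tendsto_inv_re.const_mul A).add_const B).add ((tendsto_inv_re.mul tendsto_inv_re).const_mul C)
  simp only [mul_zero, zero_add, add_zero] at h1
  refine h1.congr' ?_
  filter_upwards [eventually_re 0] with κ ⟨hκ, _⟩
  field_simp

theorem tendsto_linear (A C : ℂ) : Tendsto (fun κ : ℂ => A + 0 * κ + C / κ)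
    (comap Complex.re atTop) (𝓝 A) := by
  have h1 := (tendsto_inv_re.const_mul C).const_add A
  simp only [mul_zero, add_zero] at h1
  simpa [div_eq_mul_inv] using h1

theorem eventually_linear_ne_zero {A B : ℂ} (C : ℂ) (h : B ≠ 0 ∨ B = 0 ∧ A ≠ 0) :
    ∀ᶠ κ in comap Complex.re atTop, A + B * κ + C / κ ≠ 0 := by
  rcases h with h | ⟨rfl, h⟩
  · filter_upwards [(tendsto_linear_div A B C).eventually_ne h] with κ hκ h0
    simp [h0] at hκ
  · exact (tendsto_linear A C).eventually_ne h

theorem isBigO_linear_div_linear (A B C : ℂ) {A' B' : ℂ} (C' : ℂ)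
    (h : B' ≠ 0 ∨ B' = 0 ∧ A' ≠ 0) (hB : B' = 0 → B = 0) :
    (fun κ : ℂ => (A + B * κ + C / κ) / (A' + B' * κ + C' / κ)) =O[comap Complex.re atTop]
      fun _ => (1 : ℝ) := by
  rcases h with h | ⟨rfl, h⟩
  · have h1 := (tendsto_linear_div A B C).div (tendsto_linear_div A' B' C') h
    refine Tendsto.isBigO_one ℝ (h1.congr' ?_)
    filter_upwards [eventually_re 0] with κ ⟨hκ, _⟩
    exact div_div_div_cancel_right₀ hκ _ _
  · rw [hB rfl]
    exact ((tendsto_linear A C).div (tendsto_linear A' C') h).isBigO_one ℝ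

theorem PurelyGrowsLike.growsLike {G y dy : ℂ → ℂ} (h : PurelyGrowsLike G y dy) :
    GrowsLike G y dy := ⟨h.growing, h.decaying.isBigO_one ℝ⟩

theorem PurelyGrowsLike.tendsto {G y dy : ℂ → ℂ} (h : PurelyGrowsLike G y dy) :
    Tendsto (fun κ => y κ / G κ) (comap Complex.re atTop) (𝓝 1) := by
  have := h.growing.add h.decaying
  simp only [← add_div, growing_add_decaying, add_zero] at this
  exact this

/-- Division by zero gives 0, which is excluded near a limit equal to 1. -/
theorem GrowsLike.eventually_ne {G y dy : ℂ → ℂ} (h : GrowsLike G y dy) :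
    ∀ᶠ κ in comap Complex.re atTop, G κ ≠ 0 := by
  filter_upwards [h.growing.eventually_ne one_ne_zero] with κ hκ h0
  simp [h0] at hκ

/-- Cauchy data that do not depend on `κ` are of growing type, with a leading term determined by
the data. -/
theorem GrowsLike.const {c d : ℂ} (h : c ≠ 0 ∨ c = 0 ∧ d ≠ 0) :
    GrowsLike (fun κ => TransferSL.growing κ c d) (fun _ => c) fun _ => d := by
  have hne := eventually_linear_ne_zero 0 h
  constructor
  · refine tendsto_const_nhds.congr' ?_
    filter_upwards [hne, eventually_re 0] with κ h1 ⟨hκ, _⟩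
    rw [div_self]
    intro h2
    apply h1
    unfold TransferSL.growing at h2
    field_simp at h2
    linear_combination h2
  · refine (isBigO_linear_div_linear (-d) c 0 0 h id).congr' ?_ EventuallyEq.rfl
    filter_upwards [eventually_re 0] with κ ⟨hκ, _⟩
    unfold TransferSL.growing TransferSL.decaying
    rw [← mul_div_mul_left ((c - d / κ) / 2) _ (mul_ne_zero two_ne_zero hκ)]
    congr 1 <;> field_simp <;> ring

/-- Cauchy data of growing type become purely growing under the flow of the equation. -/
theorem GrowsLike.solvesOn {q : ℝ → ℝ} {a b : ℝ} {y dy : ℂ → ℝ → ℂ} {G : ℂ → ℂ} (hab : a < b)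
    (hq : IntervalIntegrable q volume a b)
    (h : ∀ κ, SolvesOn q (-κ ^ 2) a b (y κ) (dy κ))
    (hG : GrowsLike G (fun κ => y κ a) fun κ => dy κ a) :
    PurelyGrowsLike (fun κ => Complex.exp (κ * (b - a)) * G κ) (fun κ => y κ b)
      fun κ => dy κ b := by
  have hb : b ∈ Set.Icc a b := Set.right_mem_Icc.2 hab.le
  have hba : 0 < b - a := sub_pos.2 hab
  set I := ∫ t in a..b, |q t| with hI
  have hinv : Tendsto (fun κ : ℂ => I / ‖κ‖) (comap Complex.re atTop) (𝓝 0) := by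
    simpa [div_eq_mul_inv] using tendsto_inv_re.norm.const_mul I
  have herr : Tendsto (fun κ : ℂ => I / ‖κ‖ * (‖TransferSL.growing κ (y κ a) (dy κ a) / G κ‖ +
      ‖TransferSL.decaying κ (y κ a) (dy κ a) / G κ‖)) (comap Complex.re atTop) (𝓝 0) := by
    have h1 : (fun κ : ℂ => ‖TransferSL.growing κ (y κ a) (dy κ a) / G κ‖ +
        ‖TransferSL.decaying κ (y κ a) (dy κ a) / G κ‖) =O[comap Complex.re atTop]
        fun _ => (1 : ℝ) :=
      (hG.growing.isBigO_one ℝ).norm_left.add hG.decaying.norm_left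
    have h2 := ((Asymptotics.isLittleO_one_iff ℝ).2 hinv).mul_isBigO h1
    simpa only [mul_one, Asymptotics.isLittleO_one_iff] using h2
  have hnE : ∀ κ : ℂ, 0 < κ.re → ‖Complex.exp (κ * (b - a))‖ = Real.exp (|κ.re| * (b - a)) := by
    intro κ hκ
    rw [Complex.norm_exp, abs_of_pos hκ, ← Complex.ofReal_sub, Complex.re_mul_ofReal]
  have hscale : ∀ κ z P N : ℂ, 0 < κ.re → ‖z‖ ≤ I / ‖κ‖ * (‖P‖ + ‖N‖) *
      Real.exp (|κ.re| * (b - a)) → ‖z / (Complex.exp (κ * (b - a)) * G κ)‖ ≤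
      I / ‖κ‖ * (‖P / G κ‖ + ‖N / G κ‖) := by
    intro κ z P N hκ hz
    rw [norm_div, norm_mul, hnE κ hκ, ← div_div]
    have h1 : ‖z‖ / Real.exp (|κ.re| * (b - a)) ≤ I / ‖κ‖ * (‖P‖ + ‖N‖) := by
      rwa [div_le_iff₀ (Real.exp_pos _)]
    calc _ ≤ I / ‖κ‖ * (‖P‖ + ‖N‖) / ‖G κ‖ := by gcongr
      _ = _ := by rw [norm_div, norm_div]; ring
  constructor
  · have h1 : Tendsto (fun κ : ℂ => (TransferSL.growing κ (y κ b) (dy κ b) -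
        Complex.exp (κ * (b - a)) * TransferSL.growing κ (y κ a) (dy κ a)) /
        (Complex.exp (κ * (b - a)) * G κ)) (comap Complex.re atTop) (𝓝 0) := by
      refine squeeze_zero_norm' ?_ herr
      filter_upwards [eventually_re (2 * I)] with κ ⟨hκ, hre, hκq⟩
      exact hscale κ _ _ _ hre ((h κ).norm_growing_sub_le hκ hab.le hq hκq hb)
    have h2 := h1.add hG.growing
    rw [zero_add] at h2
    refine h2.congr fun κ => ?_
    rw [sub_div, mul_div_mul_left _ _ (Complex.exp_ne_zero _), sub_add_cancel]
  · have h1 : Tendsto (fun κ : ℂ => (TransferSL.decaying κ (y κ b) (dy κ b) -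
        Complex.exp (-κ * (b - a)) * TransferSL.decaying κ (y κ a) (dy κ a)) /
        (Complex.exp (κ * (b - a)) * G κ)) (comap Complex.re atTop) (𝓝 0) := by
      refine squeeze_zero_norm' ?_ herr
      filter_upwards [eventually_re (2 * I)] with κ ⟨hκ, hre, hκq⟩
      exact hscale κ _ _ _ hre ((h κ).norm_decaying_sub_le hκ hab.le hq hκq hb)
    -- Relative to the growing mode, the initial decaying part is damped by `exp (-2 κ (b - a))`.
    -- Here `a < b` is essential: it upgrades a bounded ratio to a vanishing one.
    have h3 : Tendsto (fun κ : ℂ => Complex.exp (-κ * (b - a)) / Complex.exp (κ * (b - a)))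
        (comap Complex.re atTop) (𝓝 0) := by
      rw [tendsto_zero_iff_norm_tendsto_zero]
      have h4 : Tendsto (fun κ : ℂ => Real.exp (-(2 * (b - a) * κ.re))) (comap Complex.re atTop)
          (𝓝 0) :=
        Real.tendsto_exp_neg_atTop_nhds_zero.comp
          ((tendsto_comap (f := Complex.re)).const_mul_atTop (by positivity))
      refine h4.congr fun κ => ?_
      rw [← Complex.exp_sub, Complex.norm_exp, ← Complex.ofReal_sub]
      congr 1
      simp
      ring
    have h5 : Tendsto (fun κ : ℂ => Complex.exp (-κ * (b - a)) / Complex.exp (κ * (b - a)) *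
        (TransferSL.decaying κ (y κ a) (dy κ a) / G κ)) (comap Complex.re atTop) (𝓝 0) := by
      have := ((Asymptotics.isLittleO_one_iff ℝ).2 h3).mul_isBigO hG.decaying
      simpa only [mul_one, Asymptotics.isLittleO_one_iff] using this
    have h2 := h1.add h5
    rw [zero_add] at h2
    refine h2.congr fun κ => ?_
    rw [div_mul_div_comm, ← add_div, sub_add_cancel]

/-- The factor by which the transfer matrix multiplies the growing part of a solution. -/
noncomputable def transferFactor (M : Matrix (Fin 2) (Fin 2) ℝ) (κ : ℂ) : ℂ :=
  ((M 0 0 + M 1 1 : ℂ) + M 0 1 * κ + M 1 0 / κ) / 2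

/-- If `M 0 1 = 0`, the diagonal entries have product 1. Being real, they cannot also have sum 0, so
the factor never degenerates to order `1 / κ`. -/
theorem transfer_leading {M : Matrix (Fin 2) (Fin 2) ℝ} (hM : M.det = 1) :
    (M 0 1 : ℂ) ≠ 0 ∨ (M 0 1 : ℂ) = 0 ∧ (M 0 0 + M 1 1 : ℂ) ≠ 0 := by
  by_cases h : M 0 1 = 0
  · right
    refine ⟨by simp [h], ?_⟩
    rw [Matrix.det_fin_two, h] at hM
    norm_cast
    intro h0
    have : M 1 1 = -M 0 0 := by linarith
    rw [this] at hM
    nlinarith [sq_nonneg (M 0 0)]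
  · left
    exact_mod_cast h

/-- Applying `M` mixes the modes through coefficients no larger in order than `transferFactor M κ`.
The incoming decaying part is negligible, but a decaying part of comparable size may emerge, hence
only `GrowsLike`. -/
theorem PurelyGrowsLike.transfer {M : Matrix (Fin 2) (Fin 2) ℝ} (hM : M.det = 1)
    {G y dy : ℂ → ℂ} (h : PurelyGrowsLike G y dy) :
    GrowsLike (fun κ => transferFactor M κ * G κ) (fun κ => M 0 0 * y κ + M 0 1 * dy κ)
      fun κ => M 1 0 * y κ + M 1 1 * dy κ := by
  have hl := transfer_leading hM
  have hne := eventually_linear_ne_zero (M 1 0 : ℂ) hl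
  have hO : ∀ A B C : ℂ, ((M 0 1 : ℂ) = 0 → B = 0) →
      (fun κ => (A + B * κ + C / κ) / ((M 0 0 + M 1 1 : ℂ) + M 0 1 * κ + M 1 0 / κ))
        =O[comap Complex.re atTop] fun _ => (1 : ℝ) := fun A B C hB =>
    isBigO_linear_div_linear A B C _ hl hB
  constructor
  · have h1 := (hO (M 0 0 - M 1 1) (-M 0 1) (M 1 0) (by simp)).mul_isLittleO
      ((Asymptotics.isLittleO_one_iff ℝ).2 h.decaying)
    simp only [mul_one, Asymptotics.isLittleO_one_iff] at h1
    have h2 := h.growing.add h1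
    rw [add_zero] at h2
    refine h2.congr' ?_
    filter_upwards [hne, eventually_re 0, h.growsLike.eventually_ne] with κ hD ⟨hκ, _⟩ hG
    unfold transferFactor TransferSL.growing TransferSL.decaying
    generalize hDD : (M 0 0 + M 1 1 : ℂ) + M 0 1 * κ + M 1 0 / κ = D at *
    field_simp
    rw [← hDD]
    field_simp
    ring
  · have h1 := ((hO (M 0 0 - M 1 1) (M 0 1) (-M 1 0) id).mul (h.growing.isBigO_one ℝ)).add
      ((hO (M 0 0 + M 1 1) (-M 0 1) (-M 1 0) (by simp)).mul (h.decaying.isBigO_one ℝ))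
    simp only [mul_one] at h1
    refine h1.congr' ?_ EventuallyEq.rfl
    filter_upwards [hne, eventually_re 0, h.growsLike.eventually_ne] with κ hD ⟨hκ, _⟩ hG
    unfold transferFactor TransferSL.growing TransferSL.decaying
    generalize hDD : (M 0 0 + M 1 1 : ℂ) + M 0 1 * κ + M 1 0 / κ = D at *
    field_simp
    ring

/-- The leading coefficient of a boundary form on growing solutions. -/
theorem PurelyGrowsLike.boundary {G y dy : ℂ → ℂ} (h : PurelyGrowsLike G y dy) {c d : ℂ}
    (hcd : d ≠ 0 ∨ d = 0 ∧ c ≠ 0) :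
    Tendsto (fun κ => (y κ * c - dy κ * d) / ((c - d * κ) * G κ)) (comap Complex.re atTop)
      (𝓝 1) := by
  have hcd' : -d ≠ 0 ∨ -d = 0 ∧ c ≠ 0 := by simpa using hcd
  have hne := eventually_linear_ne_zero 0 hcd'
  have h1 := (isBigO_linear_div_linear c d 0 0 hcd' (by simp)).mul_isLittleO
    ((Asymptotics.isLittleO_one_iff ℝ).2 h.decaying)
  simp only [mul_one, Asymptotics.isLittleO_one_iff] at h1
  have h2 := h.growing.add h1
  rw [add_zero] at h2
  refine h2.congr' ?_
  filter_upwards [hne, eventually_re 0, h.growsLike.eventually_ne] with κ hD ⟨hκ, _⟩ hG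
  have hD' : c - d * κ ≠ 0 := by
    intro h0; apply hD; linear_combination h0
  have e1 : c + -d * κ + 0 / κ = c - d * κ := by ring
  rw [e1]
  have hy := growing_add_decaying κ (y κ) (dy κ)
  have hdy := mul_growing_sub_decaying hκ (y κ) (dy κ)
  generalize TransferSL.growing κ (y κ) (dy κ) = P at hy hdy ⊢
  generalize TransferSL.decaying κ (y κ) (dy κ) = N at hy hdy ⊢
  rw [← hy, ← hdy]
  field_simp
  ring

end TransferSL

/-! ### Solutions across the transfer point and the formula for the Weyl function. -/

namespace TransferSL

theorem SolvesOn.congr {q : ℝ → ℝ} {lam : ℂ} {a b : ℝ} {y dy z dz : ℝ → ℂ} (hab : a ≤ b)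
    (h : SolvesOn q lam a b y dy) (hy : Set.EqOn z y (Set.Icc a b))
    (hdy : Set.EqOn dz dy (Set.Icc a b)) : SolvesOn q lam a b z dz where
  hasDeriv x hx := by
    rw [hdy hx]
    exact (h.hasDeriv x hx).congr_of_mem hy hx
  absCont := h.absCont.of_dist_le fun x hx t ht => by
    rw [Set.uIcc_of_le hab] at hx ht
    rw [hdy hx, hdy ht]
  equation := by
    filter_upwards [h.equation, ae_mem_Ioo_of_restrict_Icc a b] with x ⟨s, hs, es⟩ hx
    refine ⟨s, hs.congr_of_eventuallyEq ?_, ?_⟩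
    · filter_upwards [Icc_mem_nhds hx.1 hx.2] with t ht using hdy ht
    · rw [hy (Set.Ioo_subset_Icc_self hx)]
      exact es

/-- Solutions with the same limiting Cauchy data at the left end point agree. -/
theorem SolvesOn.eq_of_tendsto {q : ℝ → ℝ} {lam : ℂ} {a b : ℝ} {y dy z dz : ℝ → ℂ} (hab : a < b)
    (hq : IntervalIntegrable q volume a b) (hz : SolvesOn q lam a b z dz)
    (hy : ∀ c ∈ Set.Ioo a b, SolvesOn q lam c b y dy)
    (h0 : Tendsto y (𝓝[>] a) (𝓝 (z a))) (h1 : Tendsto dy (𝓝[>] a) (𝓝 (dz a)))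
    {x : ℝ} (hx : x ∈ Set.Ioc a b) : y x = z x ∧ dy x = dz x := by
  have hlim : ∀ f : ℝ → ℂ, ContinuousOn f (Set.Icc a b) → Tendsto f (𝓝[>] a) (𝓝 (f a)) :=
    fun f hf => (hf a (Set.left_mem_Icc.2 hab.le)).mono_left
      (nhdsWithin_le_of_mem (mem_of_superset (Ioc_mem_nhdsGT hab) Set.Ioc_subset_Icc_self))
  -- The Wronskian of `y - z` with any solution is constant on `(a, b]` and tends to 0 at `a`. Two
  -- solutions with Wronskian 1 then force `y - z` and its derivative to vanish.
  have key : ∀ f df : ℝ → ℂ, SolvesOn q lam a b f df →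
      (y x - z x) * df x - (dy x - dz x) * f x = 0 := by
    intro f df hf
    have hf0 := hlim f hf.continuousOn
    have hf1 := hlim df (hf.continuousOn_deriv hab.le)
    have hz0 := hlim z hz.continuousOn
    have hz1 := hlim dz (hz.continuousOn_deriv hab.le)
    have ht := ((h0.sub hz0).mul hf1).sub ((h1.sub hz1).mul hf0)
    simp only [sub_self, zero_mul] at ht
    refine tendsto_nhds_unique (tendsto_const_nhds.congr' ?_) ht
    filter_upwards [Ioo_mem_nhdsGT hx.1] with c hc
    have hcb : c ∈ Set.Ioo a b := ⟨hc.1, hc.2.trans_le hx.2⟩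
    have hs : Set.Icc c b ⊆ Set.Icc a b := Set.Icc_subset_Icc_left hc.1.le
    have hd := (hy c hcb).smul_add_smul (hz.mono hcb.2.le hs) 1 (-1)
    have := hd.wronskian_eq (hf.mono hcb.2.le hs) (s := x) (t := c) ⟨hc.2.le, hx.2⟩
      (Set.left_mem_Icc.2 hcb.2.le)
    linear_combination this
  obtain ⟨C, dC, hC, -⟩ := exists_solvesOn hab.le hq 1 0
  obtain ⟨Z, dZ, hZ, -⟩ := exists_solvesOn hab.le hq 0 1
  have hW := (hC lam).1.wronskian_eq (hZ lam).1 (Set.Ioc_subset_Icc_self hx)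
    (Set.left_mem_Icc.2 hab.le)
  rw [(hC lam).2.1, (hC lam).2.2, (hZ lam).2.1, (hZ lam).2.2] at hW
  have k1 := key _ _ (hC lam).1
  have k2 := key _ _ (hZ lam).1
  constructor
  · linear_combination -(y x - z x) * hW + C lam x * k2 - Z lam x * k1
  · linear_combination -(dy x - dz x) * hW + dC lam x * k2 - dZ lam x * k1

/-- A solution of the transfer problem on `[-S, 0]` and `[0, S]`, for every spectral parameter and
entire in it. -/
structure TransferFamily (S : ℝ) (M : Matrix (Fin 2) (Fin 2) ℝ) (q : ℝ → ℝ) where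
  /-- the solution on `[-S, 0]` -/
  yl : ℂ → ℝ → ℂ
  /-- the derivative on `[-S, 0]` -/
  dyl : ℂ → ℝ → ℂ
  /-- the solution on `[0, S]` -/
  yr : ℂ → ℝ → ℂ
  /-- the derivative on `[0, S]` -/
  dyr : ℂ → ℝ → ℂ
  left : ∀ lam, SolvesOn q lam (-S) 0 (yl lam) (dyl lam)
  right : ∀ lam, SolvesOn q lam 0 S (yr lam) (dyr lam)
  jump : ∀ lam, yr lam 0 = M 0 0 * yl lam 0 + M 0 1 * dyl lam 0
  jump_deriv : ∀ lam, dyr lam 0 = M 1 0 * yl lam 0 + M 1 1 * dyl lam 0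
  entire_left : ∀ x ∈ Set.Icc (-S) 0,
    (Differentiable ℂ fun lam => yl lam x) ∧ Differentiable ℂ fun lam => dyl lam x
  entire_right : ∀ x ∈ Set.Icc 0 S,
    (Differentiable ℂ fun lam => yr lam x) ∧ Differentiable ℂ fun lam => dyr lam x

namespace TransferFamily

variable {S : ℝ} {M : Matrix (Fin 2) (Fin 2) ℝ} {q : ℝ → ℝ}

/-- The value of the solution. -/
noncomputable def val (f : TransferFamily S M q) (lam : ℂ) (x : ℝ) : ℂ :=
  if x < 0 then f.yl lam x else f.yr lam x

/-- The value of the derivative of the solution. -/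
noncomputable def dval (f : TransferFamily S M q) (lam : ℂ) (x : ℝ) : ℂ :=
  if x < 0 then f.dyl lam x else f.dyr lam x

theorem val_of_neg (f : TransferFamily S M q) (lam : ℂ) {x : ℝ} (hx : x < 0) :
    f.val lam x = f.yl lam x := if_pos hx

theorem dval_of_neg (f : TransferFamily S M q) (lam : ℂ) {x : ℝ} (hx : x < 0) :
    f.dval lam x = f.dyl lam x := if_pos hx

theorem val_of_nonneg (f : TransferFamily S M q) (lam : ℂ) {x : ℝ} (hx : 0 ≤ x) :
    f.val lam x = f.yr lam x := if_neg hx.not_gt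

theorem dval_of_nonneg (f : TransferFamily S M q) (lam : ℂ) {x : ℝ} (hx : 0 ≤ x) :
    f.dval lam x = f.dyr lam x := if_neg hx.not_gt

theorem entire (f : TransferFamily S M q) {x : ℝ} (hx : x ∈ Set.Icc (-S) S) :
    (Differentiable ℂ fun lam => f.val lam x) ∧ Differentiable ℂ fun lam => f.dval lam x := by
  rcases lt_or_ge x 0 with h | h
  · simpa only [f.val_of_neg _ h, f.dval_of_neg _ h] using f.entire_left x ⟨hx.1, h.le⟩
  · simpa only [f.val_of_nonneg _ h, f.dval_of_nonneg _ h] using f.entire_right x ⟨h, hx.2⟩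

/-- Linear combinations of families, with entire coefficients. -/
def combine (f g : TransferFamily S M q) (c d : ℂ → ℂ) (hc : Differentiable ℂ c)
    (hd : Differentiable ℂ d) : TransferFamily S M q where
  yl lam x := c lam * f.yl lam x + d lam * g.yl lam x
  dyl lam x := c lam * f.dyl lam x + d lam * g.dyl lam x
  yr lam x := c lam * f.yr lam x + d lam * g.yr lam x
  dyr lam x := c lam * f.dyr lam x + d lam * g.dyr lam x
  left lam := (f.left lam).smul_add_smul (g.left lam) _ _
  right lam := (f.right lam).smul_add_smul (g.right lam) _ _
  jump lam := by rw [f.jump, g.jump]; ring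
  jump_deriv lam := by rw [f.jump_deriv, g.jump_deriv]; ring
  entire_left x hx := ⟨(hc.mul (f.entire_left x hx).1).add (hd.mul (g.entire_left x hx).1),
    (hc.mul (f.entire_left x hx).2).add (hd.mul (g.entire_left x hx).2)⟩
  entire_right x hx := ⟨(hc.mul (f.entire_right x hx).1).add (hd.mul (g.entire_right x hx).1),
    (hc.mul (f.entire_right x hx).2).add (hd.mul (g.entire_right x hx).2)⟩

theorem val_combine (f g : TransferFamily S M q) {c d : ℂ → ℂ} (hc : Differentiable ℂ c)
    (hd : Differentiable ℂ d) (lam : ℂ) (x : ℝ) :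
    (f.combine g c d hc hd).val lam x = c lam * f.val lam x + d lam * g.val lam x := by
  unfold val combine; split_ifs <;> rfl

theorem dval_combine (f g : TransferFamily S M q) {c d : ℂ → ℂ} (hc : Differentiable ℂ c)
    (hd : Differentiable ℂ d) (lam : ℂ) (x : ℝ) :
    (f.combine g c d hc hd).dval lam x = c lam * f.dval lam x + d lam * g.dval lam x := by
  unfold dval combine; split_ifs <;> rfl

/-- The data at `0⁺` depend on `lam`, whereas `exists_solvesOn` takes fixed data. The right half is
therefore a combination of a fundamental system with entire coefficients. -/
theorem exists_of_data (hS : 0 < S) (hl : IntervalIntegrable q volume (-S) 0)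
    (hr : IntervalIntegrable q volume 0 S) (c d : ℂ) :
    ∃ f : TransferFamily S M q, ∀ lam, f.yl lam (-S) = c ∧ f.dyl lam (-S) = d := by
  have hS' : -S ≤ 0 := by linarith
  obtain ⟨Y, dY, hY, hYd⟩ := exists_solvesOn hS' hl c d
  obtain ⟨C, dC, hC, hCd⟩ := exists_solvesOn hS.le hr 1 0
  obtain ⟨Z, dZ, hZ, hZd⟩ := exists_solvesOn hS.le hr 0 1
  have h0 := hYd 0 (Set.right_mem_Icc.2 hS')
  have hc : Differentiable ℂ fun lam => M 0 0 * Y lam 0 + M 0 1 * dY lam 0 :=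
    (h0.1.const_mul _).add (h0.2.const_mul _)
  have hd : Differentiable ℂ fun lam => M 1 0 * Y lam 0 + M 1 1 * dY lam 0 :=
    (h0.1.const_mul _).add (h0.2.const_mul _)
  refine ⟨{ yl := Y, dyl := dY
            yr := fun lam x => (M 0 0 * Y lam 0 + M 0 1 * dY lam 0) * C lam x +
              (M 1 0 * Y lam 0 + M 1 1 * dY lam 0) * Z lam x
            dyr := fun lam x => (M 0 0 * Y lam 0 + M 0 1 * dY lam 0) * dC lam x +
              (M 1 0 * Y lam 0 + M 1 1 * dY lam 0) * dZ lam x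
            left := fun lam => (hY lam).1
            right := fun lam => (hC lam).1.smul_add_smul (hZ lam).1 _ _
            jump := fun lam => ?_
            jump_deriv := fun lam => ?_
            entire_left := hYd
            entire_right := fun x hx => ⟨(hc.mul (hCd x hx).1).add (hd.mul (hZd x hx).1),
              (hc.mul (hCd x hx).2).add (hd.mul (hZd x hx).2)⟩ }, fun lam => (hY lam).2⟩
  · rw [(hC lam).2.1, (hZ lam).2.1]; ring
  · rw [(hC lam).2.2, (hZ lam).2.2]; ring

/-- The Wronskian of two families does not depend on the point. -/
theorem wronskian_eq (hM : M.det = 1) (f g : TransferFamily S M q) (lam : ℂ) {x : ℝ}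
    (hx : x ∈ Set.Icc (-S) S) :
    f.val lam x * g.dval lam x - f.dval lam x * g.val lam x =
      f.yl lam (-S) * g.dyl lam (-S) - f.dyl lam (-S) * g.yl lam (-S) := by
  rcases lt_or_ge x 0 with h | h
  · rw [f.val_of_neg _ h, g.val_of_neg _ h, f.dval_of_neg _ h, g.dval_of_neg _ h]
    exact (f.left lam).wronskian_eq (g.left lam) ⟨hx.1, h.le⟩ ⟨le_rfl, hx.1.trans h.le⟩
  · rw [f.val_of_nonneg _ h, g.val_of_nonneg _ h, f.dval_of_nonneg _ h, g.dval_of_nonneg _ h]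
    have hS : 0 ≤ S := h.trans hx.2
    rw [(f.right lam).wronskian_eq (g.right lam) ⟨h, hx.2⟩ ⟨le_rfl, hS⟩,
      (f.left lam).wronskian_eq (g.left lam) (s := -S) (t := 0) ⟨le_rfl, by linarith⟩
        ⟨by linarith, le_rfl⟩, f.jump, f.jump_deriv, g.jump, g.jump_deriv]
    rw [Matrix.det_fin_two] at hM
    have hM' : (M 0 0 : ℂ) * M 1 1 - M 0 1 * M 1 0 = 1 := by exact_mod_cast hM
    linear_combination (f.yl lam 0 * g.dyl lam 0 - f.dyl lam 0 * g.yl lam 0) * hM'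

theorem isSolution (hS : 0 < S) (f : TransferFamily S M q) (lam : ℂ) :
    IsSolution S M q lam (f.val lam) (f.dval lam) where
  left c hc := ((f.left lam).mono hc.1.le (Set.Icc_subset_Icc_right hc.2.le)).congr hc.1.le
    (fun _ hx => f.val_of_neg lam (hx.2.trans_lt hc.2))
    fun _ hx => f.dval_of_neg lam (hx.2.trans_lt hc.2)
  right c hc := ((f.right lam).mono hc.2.le (Set.Icc_subset_Icc_left hc.1.le)).congr hc.2.le
    (fun _ hx => f.val_of_nonneg lam (hc.1.le.trans hx.1))
    fun _ hx => f.dval_of_nonneg lam (hc.1.le.trans hx.1)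
  transfer := by
    have hS' : -S < 0 := by linarith
    have hl : ∀ g : ℝ → ℂ, ContinuousOn g (Set.Icc (-S) 0) → Tendsto g (𝓝[<] 0) (𝓝 (g 0)) :=
      fun g hg => (hg 0 (Set.right_mem_Icc.2 hS'.le)).mono_left
        (nhdsWithin_le_of_mem (mem_of_superset (Ico_mem_nhdsLT hS') Set.Ico_subset_Icc_self))
    have hr : ∀ g : ℝ → ℂ, ContinuousOn g (Set.Icc 0 S) → Tendsto g (𝓝[>] 0) (𝓝 (g 0)) :=
      fun g hg => (hg 0 (Set.left_mem_Icc.2 hS.le)).mono_left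
        (nhdsWithin_le_of_mem (mem_of_superset (Ioc_mem_nhdsGT hS) Set.Ioc_subset_Icc_self))
    refine ⟨_, _, _, _, (hl _ (f.left lam).continuousOn).congr' ?_,
      (hl _ ((f.left lam).continuousOn_deriv hS'.le)).congr' ?_,
      (hr _ (f.right lam).continuousOn).congr' ?_,
      (hr _ ((f.right lam).continuousOn_deriv hS.le)).congr' ?_, f.jump lam, f.jump_deriv lam⟩
    · filter_upwards [self_mem_nhdsWithin] with x hx using (f.val_of_neg lam hx).symm
    · filter_upwards [self_mem_nhdsWithin] with x hx using (f.dval_of_neg lam hx).symm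
    · filter_upwards [self_mem_nhdsWithin] with x hx
        using (f.val_of_nonneg lam (le_of_lt hx)).symm
    · filter_upwards [self_mem_nhdsWithin] with x hx
        using (f.dval_of_nonneg lam (le_of_lt hx)).symm

/-- A solution of the transfer problem is determined by its Cauchy data at `-S`. -/
theorem eq_of_isSolution (hS : 0 < S) (hl : IntervalIntegrable q volume (-S) 0)
    (hr : IntervalIntegrable q volume 0 S) (f : TransferFamily S M q) {lam : ℂ} {y dy : ℝ → ℂ}
    (h : IsSolution S M q lam y dy) (h0 : y (-S) = f.yl lam (-S)) (h1 : dy (-S) = f.dyl lam (-S)) :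
    y S = f.yr lam S ∧ dy S = f.dyr lam S := by
  have hS' : -S < 0 := by linarith
  have hleft : ∀ x ∈ Set.Ioo (-S) 0, y x = f.yl lam x ∧ dy x = f.dyl lam x := by
    intro x hx
    have hs := h.left x hx
    have hsub : Set.uIcc (-S) x ⊆ Set.uIcc (-S) 0 := by
      rw [Set.uIcc_of_le hx.1.le, Set.uIcc_of_le hS'.le]
      exact Set.Icc_subset_Icc_right hx.2.le
    have hnh : 𝓝[>] (-S) ≤ 𝓝[Set.Icc (-S) x] (-S) := nhdsWithin_le_of_mem
      (mem_of_superset (Ioc_mem_nhdsGT hx.1) Set.Ioc_subset_Icc_self)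
    have hm : -S ∈ Set.Icc (-S) x := Set.left_mem_Icc.2 hx.1.le
    refine ((f.left lam).mono hx.1.le (Set.Icc_subset_Icc_right hx.2.le)).eq_of_tendsto hx.1
      (hl.mono_set hsub) (fun c hc => hs.mono hc.2.le (Set.Icc_subset_Icc_left hc.1.le)) ?_ ?_
      (Set.right_mem_Ioc.2 hx.1)
    · rw [← h0]; exact (hs.continuousOn _ hm).mono_left hnh
    · rw [← h1]; exact (hs.continuousOn_deriv hx.1.le _ hm).mono_left hnh
  obtain ⟨yl, dyl, yr, dyr, t1, t2, t3, t4, e1, e2⟩ := h.transfer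
  have hlim : ∀ g k : ℝ → ℂ, ContinuousOn g (Set.Icc (-S) 0) →
      (∀ x ∈ Set.Ioo (-S) 0, k x = g x) → ∀ c, Tendsto k (𝓝[<] 0) (𝓝 c) → c = g 0 := by
    intro g k hg hkg c hc
    have hg0 : Tendsto g (𝓝[<] 0) (𝓝 (g 0)) := (hg 0 (Set.right_mem_Icc.2 hS'.le)).mono_left
      (nhdsWithin_le_of_mem (mem_of_superset (Ico_mem_nhdsLT hS') Set.Ico_subset_Icc_self))
    refine tendsto_nhds_unique (hc.congr' ?_) hg0
    filter_upwards [Ioo_mem_nhdsLT hS'] with x hx using hkg x hx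
  have hyl := hlim _ _ (f.left lam).continuousOn (fun x hx => (hleft x hx).1) _ t1
  have hdyl := hlim _ _ ((f.left lam).continuousOn_deriv hS'.le) (fun x hx => (hleft x hx).2) _ t2
  rw [hyl, hdyl, ← f.jump] at e1
  rw [hyl, hdyl, ← f.jump_deriv] at e2
  rw [e1] at t3
  rw [e2] at t4
  exact (f.right lam).eq_of_tendsto hS hr h.right t3 t4 (Set.right_mem_Ioc.2 hS)

/-- The boundary form `y(S) cos β - y'(S) sin β`. -/
noncomputable def boundary (f : TransferFamily S M q) (β : ℝ) (lam : ℂ) : ℂ :=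
  f.yr lam S * (Real.cos β : ℂ) - f.dyr lam S * (Real.sin β : ℂ)

/-- Cauchy data at `-S` determine a solution at `S`, so being a Weyl value is the linear equation
`B(u) + m B(w) = 0`, uniquely solvable when `B(w) ≠ 0`. -/
theorem mem_titchmarshWeyl (hS : 0 < S) (hl : IntervalIntegrable q volume (-S) 0)
    (hr : IntervalIntegrable q volume 0 S) {α β : ℝ} (u w : TransferFamily S M q)
    (hu : ∀ lam, u.yl lam (-S) = (Real.cos α : ℂ) ∧ u.dyl lam (-S) = -(Real.sin α : ℂ))
    (hw : ∀ lam, w.yl lam (-S) = (Real.sin α : ℂ) ∧ w.dyl lam (-S) = (Real.cos α : ℂ))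
    {lam : ℂ} (hB : w.boundary β lam ≠ 0) :
    -(u.boundary β lam / w.boundary β lam) ∈ titchmarshWeyl S M α β q lam := by
  have hS' : -S < 0 := by linarith
  have hiff : ∀ m, IsWeylValue S M α β q lam m ↔ m = -(u.boundary β lam / w.boundary β lam) := by
    intro m
    have hval : u.boundary β lam + m * w.boundary β lam = 0 ↔
        m = -(u.boundary β lam / w.boundary β lam) := by
      constructor
      · intro h0
        field_simp
        linear_combination h0
      · rintro rfl
        field_simp
        ring
    rw [← hval]
    constructor
    · rintro ⟨U, dU, W, dW, hU, hW, u1, u2, w1, w2, hb⟩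
      have e1 := u.eq_of_isSolution hS hl hr hU (u1.trans (hu lam).1.symm)
        (u2.trans (hu lam).2.symm)
      have e2 := w.eq_of_isSolution hS hl hr hW (w1.trans (hw lam).1.symm)
        (w2.trans (hw lam).2.symm)
      rw [e1.1, e1.2, e2.1, e2.2] at hb
      unfold boundary
      linear_combination hb
    · intro hb
      refine ⟨_, _, _, _, u.isSolution hS lam, w.isSolution hS lam, ?_, ?_, ?_, ?_, ?_⟩
      · rw [u.val_of_neg _ hS', (hu lam).1]
      · rw [u.dval_of_neg _ hS', (hu lam).2]
      · rw [w.val_of_neg _ hS', (hw lam).1]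
      · rw [w.dval_of_neg _ hS', (hw lam).2]
      · rw [u.val_of_nonneg _ hS.le, u.dval_of_nonneg _ hS.le, w.val_of_nonneg _ hS.le,
          w.dval_of_nonneg _ hS.le]
        unfold boundary at hb
        linear_combination hb
  have hex : ∃! m, IsWeylValue S M α β q lam m :=
    ⟨_, (hiff _).2 rfl, fun m hm => (hiff m).1 hm⟩
  exact ⟨hex, (hiff _).1 hex.choose_spec.1⟩

end TransferFamily

end TransferSL

/-! ### Potential-independent growth factors, the Green function, and recovery of the potential. -/

namespace TransferSL

namespace TransferFamily

variable {S : ℝ} {M : Matrix (Fin 2) (Fin 2) ℝ}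

/-- The boundary form of a family growing from `x` has a leading term that does not depend on the
potential. -/
theorem exists_boundary_factor (hM : M.det = 1) (β : ℝ) {x : ℝ}
    (hx : x ∈ Set.Ioo (-S) 0 ∪ Set.Ioo 0 S) : ∃ H : ℂ → ℂ, ∀ q : ℝ → ℝ,
      IntervalIntegrable q volume (-S) 0 → IntervalIntegrable q volume 0 S →
      ∀ (f : TransferFamily S M q) (G : ℂ → ℂ),
        GrowsLike G (fun κ => f.val (-κ ^ 2) x) (fun κ => f.dval (-κ ^ 2) x) →
        Tendsto (fun κ => f.boundary β (-κ ^ 2) / (H κ * G κ)) (comap Complex.re atTop) (𝓝 1) := by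
  have hβ : (Real.sin β : ℂ) ≠ 0 ∨ (Real.sin β : ℂ) = 0 ∧ (Real.cos β : ℂ) ≠ 0 := by
    by_cases h : Real.sin β = 0
    · right
      refine ⟨by exact_mod_cast h, ?_⟩
      intro h0
      have h0' : Real.cos β = 0 := by exact_mod_cast h0
      have := Real.sin_sq_add_cos_sq β
      rw [h, h0'] at this
      norm_num at this
    · left
      exact_mod_cast h
  rcases hx with hx | hx
  · have hS : 0 < S := by linarith [hx.1, hx.2]
    -- Read from the right: flow from `x` to `0`, the jump, flow from `0` to `S`, then the boundary
    -- form applied to a purely growing solution.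
    refine ⟨fun κ => (Real.cos β - Real.sin β * κ : ℂ) * (Complex.exp (κ * (S - (0 : ℝ))) *
      (transferFactor M κ * Complex.exp (κ * ((0 : ℝ) - x)))), fun q hl hr f G hG => ?_⟩
    simp only [f.val_of_neg _ hx.2, f.dval_of_neg _ hx.2] at hG
    have hsub : Set.uIcc x 0 ⊆ Set.uIcc (-S) 0 := by
      rw [Set.uIcc_of_le hx.2.le, Set.uIcc_of_le (by linarith)]
      exact Set.Icc_subset_Icc_left hx.1.le
    have h0 := (hG.solvesOn hx.2 (hl.mono_set hsub) (fun κ => (f.left (-κ ^ 2)).mono hx.2.le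
      (Set.Icc_subset_Icc_left hx.1.le))).transfer hM
    simp only [← f.jump, ← f.jump_deriv] at h0
    refine ((h0.solvesOn hS hr (fun κ => f.right (-κ ^ 2))).boundary hβ).congr fun κ => ?_
    unfold boundary
    simp only [mul_assoc]
  · refine ⟨fun κ => (Real.cos β - Real.sin β * κ : ℂ) * Complex.exp (κ * (S - x)),
      fun q _ hr f G hG => ?_⟩
    simp only [f.val_of_nonneg _ hx.1.le, f.dval_of_nonneg _ hx.1.le] at hG
    have hsub : Set.uIcc x S ⊆ Set.uIcc 0 S := by
      rw [Set.uIcc_of_le hx.2.le, Set.uIcc_of_le (hx.1.trans hx.2).le]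
      exact Set.Icc_subset_Icc_left hx.1.le
    refine ((hG.solvesOn hx.2 (hr.mono_set hsub) (fun κ => (f.right (-κ ^ 2)).mono hx.2.le
      (Set.Icc_subset_Icc_left hx.1.le))).boundary hβ).congr fun κ => ?_
    unfold boundary
    simp only [mul_assoc]

/-- A family with fixed initial data is purely growing, with a leading term that does not depend on
the potential. -/
theorem exists_growth_factor (hM : M.det = 1) {c d : ℂ} (hcd : c ≠ 0 ∨ c = 0 ∧ d ≠ 0) {x : ℝ}
    (hx : x ∈ Set.Ioo (-S) 0 ∪ Set.Ioo 0 S) : ∃ G : ℂ → ℂ, ∀ q : ℝ → ℝ,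
      IntervalIntegrable q volume (-S) 0 → IntervalIntegrable q volume 0 S →
      ∀ f : TransferFamily S M q, (∀ lam, f.yl lam (-S) = c ∧ f.dyl lam (-S) = d) →
        PurelyGrowsLike G (fun κ => f.val (-κ ^ 2) x) (fun κ => f.dval (-κ ^ 2) x) := by
  have h0 : ∀ (q : ℝ → ℝ) (f : TransferFamily S M q),
      (∀ lam, f.yl lam (-S) = c ∧ f.dyl lam (-S) = d) → GrowsLike (fun κ => growing κ c d)
        (fun κ => f.yl (-κ ^ 2) (-S)) fun κ => f.dyl (-κ ^ 2) (-S) := by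
    intro q f hf
    simp only [(hf _).1, (hf _).2]
    exact GrowsLike.const hcd
  rcases hx with hx | hx
  · refine ⟨fun κ => Complex.exp (κ * (x - (-S : ℝ))) * growing κ c d, fun q hl _ f hf => ?_⟩
    have hsub : Set.uIcc (-S) x ⊆ Set.uIcc (-S) 0 := by
      rw [Set.uIcc_of_le hx.1.le, Set.uIcc_of_le (hx.1.trans hx.2).le]
      exact Set.Icc_subset_Icc_right hx.2.le
    simp only [f.val_of_neg _ hx.2, f.dval_of_neg _ hx.2]
    exact (h0 q f hf).solvesOn hx.1 (hl.mono_set hsub) fun κ => (f.left (-κ ^ 2)).mono hx.1.le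
      (Set.Icc_subset_Icc_right hx.2.le)
  · have hS : 0 < S := hx.1.trans hx.2
    refine ⟨fun κ => Complex.exp (κ * (x - (0 : ℝ))) * (transferFactor M κ *
      (Complex.exp (κ * ((0 : ℝ) - (-S : ℝ))) * growing κ c d)), fun q hl hr f hf => ?_⟩
    have hsub : Set.uIcc 0 x ⊆ Set.uIcc 0 S := by
      rw [Set.uIcc_of_le hx.1.le, Set.uIcc_of_le hS.le]
      exact Set.Icc_subset_Icc_right hx.2.le
    simp only [f.val_of_nonneg _ hx.1.le, f.dval_of_nonneg _ hx.1.le]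
    have h1 := ((h0 q f hf).solvesOn (by linarith) hl fun κ => f.left (-κ ^ 2)).transfer hM
    simp only [← f.jump, ← f.jump_deriv] at h1
    exact h1.solvesOn hx.1 (hr.mono_set hsub) fun κ => (f.right (-κ ^ 2)).mono hx.1.le
      (Set.Icc_subset_Icc_right hx.2.le)

theorem expGrowth {q : ℝ → ℝ} (hS : 0 < S) (hl : IntervalIntegrable q volume (-S) 0)
    (hr : IntervalIntegrable q volume 0 S) (f : TransferFamily S M q) {c d : ℂ}
    (hf : ∀ lam, f.yl lam (-S) = c ∧ f.dyl lam (-S) = d) {x : ℝ} (hx : x ∈ Set.Icc (-S) S) :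
    ExpGrowth fun κ => f.val (-κ ^ 2) x := by
  have hleft : ∀ x ∈ Set.Icc (-S) 0, ExpGrowth (fun κ => f.yl (-κ ^ 2) x) ∧
      ExpGrowth fun κ => f.dyl (-κ ^ 2) x := fun x hx =>
    ExpGrowth.solvesOn (by linarith) hl (fun κ => f.left (-κ ^ 2))
      (by simpa only [(hf _).1] using ExpGrowth.const c)
      (by simpa only [(hf _).2] using ExpGrowth.const d) hx
  rcases lt_or_ge x 0 with h | h
  · simpa only [f.val_of_neg _ h] using (hleft x ⟨hx.1, h.le⟩).1
  · simp only [f.val_of_nonneg _ h]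
    have h0 := hleft 0 ⟨by linarith, le_rfl⟩
    refine (ExpGrowth.solvesOn hS.le hr (fun κ => f.right (-κ ^ 2)) ?_ ?_ ⟨h, hx.2⟩).1
    · simp only [f.jump]
      exact ((ExpGrowth.const _).mul h0.1).add ((ExpGrowth.const _).mul h0.2)
    · simp only [f.jump_deriv]
      exact ((ExpGrowth.const _).mul h0.1).add ((ExpGrowth.const _).mul h0.2)

end TransferFamily

/-- The diagonal of the Green function tends to zero; `f` may be any quantity of the same growth as
the solution with initial data at `-S`. -/
theorem TransferFamily.tendsto_green {S : ℝ} {M : Matrix (Fin 2) (Fin 2) ℝ} {q : ℝ → ℝ}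
    (hM : M.det = 1) {β : ℝ} {x : ℝ} (hx : x ∈ Set.Ioo (-S) 0 ∪ Set.Ioo 0 S)
    (hl : IntervalIntegrable q volume (-S) 0) (hr : IntervalIntegrable q volume 0 S)
    (u w : TransferFamily S M q)
    (hW : ∀ lam, u.yl lam (-S) * w.dyl lam (-S) - u.dyl lam (-S) * w.yl lam (-S) = 1)
    {G f : ℂ → ℂ} (hw : PurelyGrowsLike G (fun κ => w.val (-κ ^ 2) x) fun κ => w.dval (-κ ^ 2) x)
    (hf : Tendsto (fun κ => f κ / G κ) (comap Complex.re atTop) (𝓝 1)) :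
    (∀ᶠ κ in comap Complex.re atTop, w.boundary β (-κ ^ 2) ≠ 0) ∧
    Tendsto (fun κ => f κ * (u.val (-κ ^ 2) x -
      u.boundary β (-κ ^ 2) / w.boundary β (-κ ^ 2) * w.val (-κ ^ 2) x))
      (comap Complex.re atTop) (𝓝 0) := by
  obtain ⟨H, hH⟩ := TransferFamily.exists_boundary_factor hM β hx
  have hxI : x ∈ Set.Icc (-S) S := by
    rcases hx with hx | hx
    · exact ⟨hx.1.le, by linarith [hx.1, hx.2]⟩
    · exact ⟨by linarith [hx.1, hx.2], hx.2.le⟩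
  have h1 := hH q hl hr w G hw.growsLike
  have hBne : ∀ᶠ κ in comap Complex.re atTop, w.boundary β (-κ ^ 2) ≠ 0 := by
    filter_upwards [h1.eventually_ne one_ne_zero] with κ hκ h0
    simp [h0] at hκ
  refine ⟨hBne, ?_⟩
  -- `η` is the solution with data `(0, 1)` at `x`, and `ψ(x) = B(η) / B(w)`. The unknown factor `H`
  -- cancels in this quotient.
  set η := w.combine u (fun lam => u.val lam x) (fun lam => -w.val lam x) (u.entire hxI).1
    (w.entire hxI).1.neg with hη
  have hηv : ∀ lam, η.val lam x = 0 := fun lam => by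
    rw [hη, TransferFamily.val_combine]; ring
  have hηd : ∀ lam, η.dval lam x = 1 := fun lam => by
    rw [hη, TransferFamily.dval_combine, ← hW lam, ← u.wronskian_eq hM w lam hxI]; ring
  have hηB : ∀ lam, η.boundary β lam =
      u.val lam x * w.boundary β lam - w.val lam x * u.boundary β lam := fun lam => by
    rw [hη]
    unfold TransferFamily.boundary TransferFamily.combine
    ring
  -- The data `(0, 1)` have growing part `1 / (2κ)`, which is the source of the decay of the Green
  -- function.
  have h2 := hH q hl hr η (fun κ => growing κ 0 1) (by
    simp only [hηv, hηd]
    exact GrowsLike.const (Or.inr ⟨rfl, one_ne_zero⟩))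
  have h3 : Tendsto (fun κ : ℂ => growing κ 0 1) (comap Complex.re atTop) (𝓝 0) := by
    have := tendsto_inv_re.div_const 2
    rw [zero_div] at this
    refine this.congr fun κ => ?_
    unfold growing
    rw [zero_add, one_div]
  have h4 := ((hf.mul h2).div h1 one_ne_zero).mul h3
  rw [mul_zero] at h4
  refine h4.congr' ?_
  filter_upwards [hBne, h1.eventually_ne one_ne_zero, hw.growsLike.eventually_ne,
    (GrowsLike.const (Or.inr ⟨rfl, one_ne_zero⟩ : (0 : ℂ) ≠ 0 ∨ (0 : ℂ) = 0 ∧ (1 : ℂ) ≠ 0)).eventually_ne]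
    with κ hB hHG hG hg
  have hHne : H κ ≠ 0 := by
    intro h0; simp [h0] at hHG
  simp only [Pi.div_apply]
  rw [hηB]
  field_simp

/-- If the products `z u` and `y v` of solutions of two equations agree on an open set, and the
Wronskians of `u, y` and of `v, z` are one, then the potentials agree almost everywhere on the part
of that set where `y` does not vanish. -/
theorem ae_eq_of_mul_eq {q q' : ℝ → ℝ} {lam : ℂ} {a b : ℝ} {u du y dy v dv z dz : ℝ → ℂ}
    (hu : SolvesOn q lam a b u du) (hy : SolvesOn q lam a b y dy)
    (hv : SolvesOn q' lam a b v dv) (hz : SolvesOn q' lam a b z dz)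
    (hW : ∀ x ∈ Set.Ioo a b, u x * dy x - du x * y x = 1)
    (hW' : ∀ x ∈ Set.Ioo a b, v x * dz x - dv x * z x = 1)
    (hmul : ∀ x ∈ Set.Ioo a b, z x * u x = y x * v x) :
    ∀ᵐ x ∂(volume.restrict (Set.Icc a b)), y x ≠ 0 → q x = q' x := by
  have hd : ∀ {q : ℝ → ℝ} {f df : ℝ → ℂ}, SolvesOn q lam a b f df → ∀ x ∈ Set.Ioo a b,
      HasDerivAt f (df x) x := fun h x hx =>
    (h.hasDeriv x (Set.Ioo_subset_Icc_self hx)).hasDerivAt (Icc_mem_nhds hx.1 hx.2)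
  -- Formally `(u / y)' = -1 / y ^ 2` and `(v / z)' = -1 / z ^ 2`. The polynomial form of this
  -- comparison avoids dividing by possible zeros.
  have hsq : ∀ x ∈ Set.Ioo a b, z x * z x = y x * y x := by
    intro x hx
    have h1 : HasDerivAt (fun t => z t * u t) (dz x * u x + z x * du x) x :=
      (hd hz x hx).mul (hd hu x hx)
    have h2 : HasDerivAt (fun t => y t * v t) (dy x * v x + y x * dv x) x :=
      (hd hy x hx).mul (hd hv x hx)
    have h3 := h1.unique (h2.congr_of_eventuallyEq
      (by filter_upwards [Ioo_mem_nhds hx.1 hx.2] with t ht using hmul t ht))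
    linear_combination y x * y x * hW' x hx - z x * z x * hW x hx - y x * z x * h3 +
      (z x * dy x + y x * dz x) * hmul x hx
  have hdsq : ∀ x ∈ Set.Ioo a b, z x * dz x = y x * dy x := by
    intro x hx
    have h1 : HasDerivAt (fun t => z t * z t) (dz x * z x + z x * dz x) x :=
      (hd hz x hx).mul (hd hz x hx)
    have h2 : HasDerivAt (fun t => y t * y t) (dy x * y x + y x * dy x) x :=
      (hd hy x hx).mul (hd hy x hx)
    have h3 := h1.unique (h2.congr_of_eventuallyEq
      (by filter_upwards [Ioo_mem_nhds hx.1 hx.2] with t ht using hsq t ht))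
    linear_combination h3 / 2
  filter_upwards [hy.ae_hasDerivAt, hz.ae_hasDerivAt, ae_mem_Ioo_of_restrict_Icc a b]
    with x ⟨y1, y2⟩ ⟨z1, z2⟩ hx hne
  have h1 : HasDerivAt (fun t => z t * dz t) (dz x * dz x + z x * ((q' x - lam) * z x)) x :=
    z1.mul z2
  have h2 : HasDerivAt (fun t => y t * dy t) (dy x * dy x + y x * ((q x - lam) * y x)) x :=
    y1.mul y2
  have h3 := h1.unique (h2.congr_of_eventuallyEq
    (by filter_upwards [Ioo_mem_nhds hx.1 hx.2] with t ht using hdsq t ht))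
  have h4 := hsq x hx
  have h5 := hdsq x hx
  -- Squaring `z z' = y y'` and cancelling `z ^ 2 = y ^ 2 ≠ 0` leaves only the potentials to compare
  -- in `h3`.
  have h6 : dz x * dz x = dy x * dy x := by
    have : y x * y x * (dz x * dz x) = y x * y x * (dy x * dy x) := by
      linear_combination (z x * dz x + y x * dy x) * h5 - dz x * dz x * h4
    exact mul_left_cancel₀ (mul_ne_zero hne hne) this
  have h7 : y x * y x * (q x : ℂ) = y x * y x * (q' x : ℂ) := by
    linear_combination -h3 + h6 + (q' x - lam) * h4
  exact_mod_cast mul_left_cancel₀ (mul_ne_zero hne hne) h7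

end TransferSL

/-! ### Vanishing of the cross product and local uniqueness. -/

namespace TransferSL

variable {S : ℝ} {M : Matrix (Fin 2) (Fin 2) ℝ} {q q' : ℝ → ℝ}

/-- If the Weyl functions agree, the cross product of the solutions for the two potentials
vanishes. -/
theorem TransferFamily.cross_eq_of_weyl_eq (hS : 0 < S) (hM : M.det = 1) {α β : ℝ}
    (hl : IntervalIntegrable q volume (-S) 0) (hr : IntervalIntegrable q volume 0 S)
    (hl' : IntervalIntegrable q' volume (-S) 0) (hr' : IntervalIntegrable q' volume 0 S)
    (hm : ∀ lam : ℂ, ∀ m ∈ titchmarshWeyl S M α β q lam, ∀ m' ∈ titchmarshWeyl S M α β q' lam,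
      m = m')
    (u w : TransferFamily S M q) (u' w' : TransferFamily S M q')
    (hu : ∀ lam, u.yl lam (-S) = (Real.cos α : ℂ) ∧ u.dyl lam (-S) = -(Real.sin α : ℂ))
    (hw : ∀ lam, w.yl lam (-S) = (Real.sin α : ℂ) ∧ w.dyl lam (-S) = (Real.cos α : ℂ))
    (hu' : ∀ lam, u'.yl lam (-S) = (Real.cos α : ℂ) ∧ u'.dyl lam (-S) = -(Real.sin α : ℂ))
    (hw' : ∀ lam, w'.yl lam (-S) = (Real.sin α : ℂ) ∧ w'.dyl lam (-S) = (Real.cos α : ℂ))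
    {x : ℝ} (hx : x ∈ Set.Ioo (-S) 0 ∪ Set.Ioo 0 S) :
    (∃ lam, w.val lam x ≠ 0) ∧
      ∀ lam, w'.val lam x * u.val lam x = w.val lam x * u'.val lam x := by
  have hxI : x ∈ Set.Icc (-S) S := by
    rcases hx with hx | hx
    · exact ⟨hx.1.le, by linarith [hx.1, hx.2]⟩
    · exact ⟨by linarith [hx.1, hx.2], hx.2.le⟩
  have hpyth : (Real.cos α : ℂ) * Real.cos α + Real.sin α * Real.sin α = 1 := by
    have := Real.cos_sq_add_sin_sq α
    rw [sq, sq] at this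
    exact_mod_cast this
  have hα : (Real.sin α : ℂ) ≠ 0 ∨ (Real.sin α : ℂ) = 0 ∧ (Real.cos α : ℂ) ≠ 0 := by
    by_cases h : (Real.sin α : ℂ) = 0
    · refine Or.inr ⟨h, fun h0 => ?_⟩
      rw [h, h0] at hpyth
      simp at hpyth
    · exact Or.inl h
  obtain ⟨G, hG⟩ := TransferFamily.exists_growth_factor hM hα hx
  have hGw := hG q hl hr w hw
  have hGw' := hG q' hl' hr' w' hw'
  have hW : ∀ lam, u.yl lam (-S) * w.dyl lam (-S) - u.dyl lam (-S) * w.yl lam (-S) = 1 :=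
    fun lam => by
      rw [(hu lam).1, (hu lam).2, (hw lam).1, (hw lam).2]; linear_combination hpyth
  have hW' : ∀ lam, u'.yl lam (-S) * w'.dyl lam (-S) - u'.dyl lam (-S) * w'.yl lam (-S) = 1 :=
    fun lam => by
      rw [(hu' lam).1, (hu' lam).2, (hw' lam).1, (hw' lam).2]; linear_combination hpyth
  -- Each `ψ` is multiplied by the `w` of the other potential, which is allowed because both share
  -- the growth factor `G`.
  obtain ⟨hB, ht⟩ := TransferFamily.tendsto_green hM (β := β) hx hl hr u w hW hGw hGw'.tendsto
  obtain ⟨hB', ht'⟩ :=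
    TransferFamily.tendsto_green hM (β := β) hx hl' hr' u' w' hW' hGw' hGw.tendsto
  refine ⟨?_, fun lam => ?_⟩
  · obtain ⟨κ, hκ⟩ := (hGw.tendsto.eventually_ne one_ne_zero).exists
    exact ⟨-κ ^ 2, fun h0 => by simp [h0] at hκ⟩
  · have hzero := eq_zero_of_expGrowth_of_tendsto
      (F := fun lam => w'.val lam x * u.val lam x - w.val lam x * u'.val lam x)
      (((w'.entire hxI).1.mul (u.entire hxI).1).sub ((w.entire hxI).1.mul (u'.entire hxI).1))
      (((w'.expGrowth hS hl' hr' hw' hxI).mul (u.expGrowth hS hl hr hu hxI)).sub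
        ((w.expGrowth hS hl hr hw hxI).mul (u'.expGrowth hS hl' hr' hu' hxI)))
      (by
        have h := ht.sub ht'
        rw [sub_zero] at h
        refine h.congr' ?_
        filter_upwards [hB, hB'] with κ h1 h2
        have h3 := hm _ _ (TransferFamily.mem_titchmarshWeyl hS hl hr u w hu hw h1) _
          (TransferFamily.mem_titchmarshWeyl hS hl' hr' u' w' hu' hw' h2)
        rw [neg_inj] at h3
        rw [h3]
        ring) lam
    exact sub_eq_zero.1 hzero

/-- Local uniqueness of the potential away from the transfer point. -/
theorem TransferFamily.ae_eq_nhds (hM : M.det = 1) (u w : TransferFamily S M q)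
    (u' w' : TransferFamily S M q')
    (hW : ∀ lam, u.yl lam (-S) * w.dyl lam (-S) - u.dyl lam (-S) * w.yl lam (-S) = 1)
    (hW' : ∀ lam, u'.yl lam (-S) * w'.dyl lam (-S) - u'.dyl lam (-S) * w'.yl lam (-S) = 1)
    (hmul : ∀ x ∈ Set.Ioo (-S) 0 ∪ Set.Ioo 0 S, ∀ lam,
      w'.val lam x * u.val lam x = w.val lam x * u'.val lam x)
    {x : ℝ} (hx : x ∈ Set.Ioo (-S) 0 ∪ Set.Ioo 0 S) (hne : ∃ lam, w.val lam x ≠ 0) :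
    ∃ s ∈ 𝓝 x, volume {t ∈ s | q t ≠ q' t} = 0 := by
  obtain ⟨lam, hlam⟩ := hne
  have hfinish : ∀ a b : ℝ, x ∈ Set.Ioo a b → ∀ y : ℝ → ℂ, ContinuousOn y (Set.Icc a b) → y x ≠ 0 →
      (∀ᵐ t ∂(volume.restrict (Set.Icc a b)), y t ≠ 0 → q t = q' t) →
      ∃ s ∈ 𝓝 x, volume {t ∈ s | q t ≠ q' t} = 0 := by
    intro a b hx y hy hyx hae
    have hI : Set.Icc a b ∈ 𝓝 x := Icc_mem_nhds hx.1 hx.2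
    have hyne : ∀ᶠ t in 𝓝 x, y t ≠ 0 := (hy.continuousAt hI).eventually_ne hyx
    refine ⟨_, inter_mem hI hyne, ?_⟩
    rw [ae_restrict_iff' measurableSet_Icc, ae_iff] at hae
    refine measure_mono_null ?_ hae
    rintro t ⟨⟨h1, h2⟩, h3⟩
    simp only [Set.mem_ofPred_eq, Classical.not_imp]
    exact ⟨h1, h2, h3⟩
  rcases hx with hx | hx
  · have hsub : ∀ t ∈ Set.Ioo (-S) 0, t ∈ Set.Icc (-S) S := fun t ht =>
      ⟨ht.1.le, by linarith [ht.1, ht.2]⟩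
    refine hfinish (-S) 0 hx (w.yl lam) (w.left lam).continuousOn
      (by rwa [w.val_of_neg _ hx.2] at hlam)
      (ae_eq_of_mul_eq (u.left lam) (w.left lam) (u'.left lam) (w'.left lam)
        (fun t ht => ?_) (fun t ht => ?_) fun t ht => ?_)
    · simpa only [u.val_of_neg _ ht.2, u.dval_of_neg _ ht.2, w.val_of_neg _ ht.2,
        w.dval_of_neg _ ht.2, hW] using u.wronskian_eq hM w lam (hsub t ht)
    · simpa only [u'.val_of_neg _ ht.2, u'.dval_of_neg _ ht.2, w'.val_of_neg _ ht.2,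
        w'.dval_of_neg _ ht.2, hW'] using u'.wronskian_eq hM w' lam (hsub t ht)
    · simpa only [u.val_of_neg _ ht.2, u'.val_of_neg _ ht.2, w.val_of_neg _ ht.2,
        w'.val_of_neg _ ht.2] using hmul t (Or.inl ht) lam
  · have hsub : ∀ t ∈ Set.Ioo 0 S, t ∈ Set.Icc (-S) S := fun t ht =>
      ⟨by linarith [ht.1, ht.2], ht.2.le⟩
    refine hfinish 0 S hx (w.yr lam) (w.right lam).continuousOn
      (by rwa [w.val_of_nonneg _ hx.1.le] at hlam)
      (ae_eq_of_mul_eq (u.right lam) (w.right lam) (u'.right lam) (w'.right lam)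
        (fun t ht => ?_) (fun t ht => ?_) fun t ht => ?_)
    · simpa only [u.val_of_nonneg _ ht.1.le, u.dval_of_nonneg _ ht.1.le, w.val_of_nonneg _ ht.1.le,
        w.dval_of_nonneg _ ht.1.le, hW] using u.wronskian_eq hM w lam (hsub t ht)
    · simpa only [u'.val_of_nonneg _ ht.1.le, u'.dval_of_nonneg _ ht.1.le,
        w'.val_of_nonneg _ ht.1.le, w'.dval_of_nonneg _ ht.1.le, hW']
        using u'.wronskian_eq hM w' lam (hsub t ht)
    · simpa only [u.val_of_nonneg _ ht.1.le, u'.val_of_nonneg _ ht.1.le, w.val_of_nonneg _ ht.1.le,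
        w'.val_of_nonneg _ ht.1.le] using hmul t (Or.inr ht) lam

end TransferSL

/-- If the Titchmarsh–Weyl `m`-functions of two real potentials in `L²[-S, S]`, for the same
boundary conditions and the same transfer matrix, agree wherever both are defined, then the
potentials are equal almost everywhere on `[-S, S]`. -/
theorem theorem4p3 (S : ℝ) (hS : 0 < S)
    (M : Matrix (Fin 2) (Fin 2) ℝ) (hM : M.det = 1)
    (α β : ℝ) (hα : α ∈ Set.Ico 0 Real.pi) (hβ : β ∈ Set.Ioc 0 Real.pi)
    (q q' : ℝ → ℝ)
    (hq : MemLp q 2 (volume.restrict (Set.Icc (-S) S)))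
    (hq' : MemLp q' 2 (volume.restrict (Set.Icc (-S) S)))
    (hm : ∀ lam : ℂ,
      ∀ m ∈ TransferSL.titchmarshWeyl S M α β q lam,
      ∀ m' ∈ TransferSL.titchmarshWeyl S M α β q' lam, m = m') :
    q =ᵐ[volume.restrict (Set.Icc (-S) S)] q' := by
  have hint : ∀ p : ℝ → ℝ, MemLp p 2 (volume.restrict (Set.Icc (-S) S)) →
      IntervalIntegrable p volume (-S) 0 ∧ IntervalIntegrable p volume 0 S := by
    intro p hp
    have h1 : IntegrableOn p (Set.Icc (-S) S) volume := hp.integrable one_le_two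
    constructor
    · rw [intervalIntegrable_iff_integrableOn_Icc_of_le (by linarith)]
      exact h1.mono_set (Set.Icc_subset_Icc_right hS.le)
    · rw [intervalIntegrable_iff_integrableOn_Icc_of_le hS.le]
      exact h1.mono_set (Set.Icc_subset_Icc_left (by linarith))
  obtain ⟨hl, hr⟩ := hint q hq
  obtain ⟨hl', hr'⟩ := hint q' hq'
  obtain ⟨u, hu⟩ := TransferSL.TransferFamily.exists_of_data (M := M) hS hl hr
    (Real.cos α : ℂ) (-(Real.sin α : ℂ))
  obtain ⟨w, hw⟩ := TransferSL.TransferFamily.exists_of_data (M := M) hS hl hr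
    (Real.sin α : ℂ) (Real.cos α : ℂ)
  obtain ⟨u', hu'⟩ := TransferSL.TransferFamily.exists_of_data (M := M) hS hl' hr'
    (Real.cos α : ℂ) (-(Real.sin α : ℂ))
  obtain ⟨w', hw'⟩ := TransferSL.TransferFamily.exists_of_data (M := M) hS hl' hr'
    (Real.sin α : ℂ) (Real.cos α : ℂ)
  have hpyth : (Real.cos α : ℂ) * Real.cos α + Real.sin α * Real.sin α = 1 := by
    have := Real.cos_sq_add_sin_sq α
    rw [sq, sq] at this
    exact_mod_cast this
  have hcross := fun x (hx : x ∈ Set.Ioo (-S) 0 ∪ Set.Ioo 0 S) =>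
    TransferSL.TransferFamily.cross_eq_of_weyl_eq hS hM hl hr hl' hr' hm u w u' w' hu hw hu' hw' hx
  have hloc : ∀ x ∈ Set.Ioo (-S) 0 ∪ Set.Ioo 0 S, ∃ s ∈ 𝓝 x, volume {t ∈ s | q t ≠ q' t} = 0 :=
    fun x hx => TransferSL.TransferFamily.ae_eq_nhds hM u w u' w'
      (fun lam => by
        rw [(hu lam).1, (hu lam).2, (hw lam).1, (hw lam).2]; linear_combination hpyth)
      (fun lam => by
        rw [(hu' lam).1, (hu' lam).2, (hw' lam).1, (hw' lam).2]; linear_combination hpyth)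
      (fun t ht => (hcross t ht).2) hx (hcross x hx).1
  -- The spectral parameter used near `x` varies with `x`, so the conclusion is local and is
  -- globalised by measure theory.
  have hnull : volume {t ∈ Set.Ioo (-S) 0 ∪ Set.Ioo 0 S | q t ≠ q' t} = 0 := by
    refine measure_null_of_locally_null _ fun x hx => ?_
    obtain ⟨s, hs, hs0⟩ := hloc x hx.1
    exact ⟨{t ∈ s | q t ≠ q' t}, mem_nhdsWithin.2 ⟨interior s, isOpen_interior,
      mem_interior_iff_mem_nhds.2 hs, fun t ht => ⟨interior_subset ht.1, ht.2.2⟩⟩, hs0⟩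
  have h0 : ∀ᵐ t ∂(volume.restrict (Set.Icc (-S) S)), t ≠ 0 :=
    ae_restrict_of_ae (Measure.ae_ne volume 0)
  have hnull' : ∀ᵐ t ∂(volume.restrict (Set.Icc (-S) S)),
      ¬(t ∈ Set.Ioo (-S) 0 ∪ Set.Ioo 0 S ∧ q t ≠ q' t) :=
    ae_restrict_of_ae (measure_eq_zero_iff_ae_notMem.1 hnull)
  filter_upwards [h0, hnull', ae_mem_Ioo_of_restrict_Icc (-S) S] with t h1 h2 h3
  by_contra hne
  refine h2 ⟨?_, hne⟩
  rcases lt_or_gt_of_ne h1 with h | h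
  · exact Or.inl ⟨h3.1, h⟩
  · exact Or.inr ⟨h, h3.2⟩
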